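/- Let $\lambda>0$, $0<\alpha<1$ and let $f:(0,\infty)\to\mathbb{R}$ be continuous with $$\int_0^\infty \frac{|f(x)|}{(1+x)^{1+\lambda}}\,dx<\infty \qquad\text{and}\qquad \sup_{x,y>0,\ x\neq y}\frac{|f(x)-f(y)|}{|x-y|^\alpha}+\sup_{x>0}x^{-\alpha}|f(x)|<\infty .$$ Let $\Delta_\lambda=-\frac{d^2}{dx^2}+\frac{\lambda(\lambda-1)}{x^2}$ be the Bessel operator and, for $x,y,s>0$, let $$W_s^\lambda(x,y)=\frac{\sqrt{xy}}{2s}\,I_{\lambda-1/2}\Big(\frac{xy}{2s}\Big)e^{-(x^2+y^2)/(4s)},\qquad W_s^\lambda f(x)=\int_0^\infty W_s^\lambda(x,y)f(y)\,dy$$ be the Bessel heat kernel and the Bessel heat semigroup, where $I_\nu$ is the modified Bessel function of the first kind of order $\nu$. Define, for $x,t>0$, the Bessel--Poisson semigroup by Bochner subordination, $$v(x,t)=P_t^\lambda f(x)=\frac{t}{2\sqrt{\pi}}\int_0^\infty\frac{e^{-t^2/(4s)}}{s^{3/2}}\,W_s^\lambda f(x)\,ds .$$ Then all these integrals converge absolutely,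 and $v$ is a classical solution of $$v_{tt}-\Delta_\lambda v=0\ \text{ for } x>0,\ t>0,\qquad v(x,0)=f(x)\ \text{ for } x>0,$$ that is, $v\in C^2((0,\infty)\times(0,\infty))$, the equation holds at every point, and $\lim_{t\to0^+}v(x,t)=f(x)$ for each $x>0$. Moreover, the Poisson kernel $$P_t^\lambda(x,y)=\frac{t}{2\sqrt{\pi}}\int_0^\infty\frac{e^{-t^2/(4s)}}{s^{3/2}}\,W_s^\lambda(x,y)\,ds=\frac{1}{\sqrt{\pi}}\int_0^\infty\frac{e^{-r}}{r^{1/2}}\,W^\lambda_{t^2/(4r)}(x,y)\,dr$$ is well defined for $x,y,t>0$ (both integrals converge absolutely and agree), and $$v(x,t)=\int_0^\infty P_t^\lambda(x,y)f(y)\,dy,\qquad x,t>0,$$ with an absolutely convergent integral. -/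

import Mathlib

open MeasureTheory Set Filter Topology

namespace BesselHarmonic

noncomputable section

/-- The modified Bessel function of the first kind `I_ν(z)`, for `z > 0`, by its power series.
(At the poles of the Gamma function `1 / Γ = 0`, which is also the value of `Real.Gamma⁻¹`.) -/
def besselI (ν z : ℝ) : ℝ :=
  ∑' k : ℕ, (z / 2) ^ (2 * (k : ℝ) + ν) / ((k.factorial : ℝ) * Real.Gamma ((k : ℝ) + ν + 1))

/-- The Bessel operator `Δ_lam g = -g'' + lam (lam - 1) x⁻² g`, at the point `x > 0`. -/
def besselOp (lam : ℝ) (g : ℝ → ℝ) (x : ℝ) : ℝ :=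
  -iteratedDeriv 2 g x + lam * (lam - 1) / x ^ 2 * g x

/-- The Bessel heat kernel `W_t^lam(x, y)`, for `x, y, t > 0`. -/
def heatKernel (lam t x y : ℝ) : ℝ :=
  Real.sqrt (x * y) / (2 * t) * besselI (lam - 1 / 2) (x * y / (2 * t))
    * Real.exp (-(x ^ 2 + y ^ 2) / (4 * t))

/-- The Bessel heat semigroup `W_t^lam f(x) = ∫_0^∞ W_t^lam(x, y) f(y) dy`. -/
def heat (lam t : ℝ) (f : ℝ → ℝ) (x : ℝ) : ℝ :=
  ∫ y in Ioi (0 : ℝ), heatKernel lam t x y * f y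

/-- The Bessel-Poisson semigroup `P_t^lam f(x)`, by Bochner subordination of the heat semigroup. -/
def poisson (lam t : ℝ) (f : ℝ → ℝ) (x : ℝ) : ℝ :=
  t / (2 * Real.sqrt Real.pi) *
    ∫ s in Ioi (0 : ℝ), Real.exp (-t ^ 2 / (4 * s)) / s ^ (3 / 2 : ℝ) * heat lam s f x

/-- The Bessel-Poisson kernel `P_t^lam(x, y)`, for `x, y, t > 0`. -/
def poissonKernel (lam t x y : ℝ) : ℝ :=
  t / (2 * Real.sqrt Real.pi) *
    ∫ s in Ioi (0 : ℝ), Real.exp (-t ^ 2 / (4 * s)) / s ^ (3 / 2 : ℝ) * heatKernel lam s x y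

/-- The norm of `C^α_+`, with values in `[0, ∞]`; only the values of `f` on `(0, ∞)` matter. -/
def holderNorm (α : ℝ) (f : ℝ → ℝ) : ENNReal :=
  (⨆ x ∈ Ioi (0 : ℝ), ⨆ y ∈ Ioi (0 : ℝ), ⨆ _ : x ≠ y,
      ENNReal.ofReal (|f x - f y| / |x - y| ^ α))
    + ⨆ x ∈ Ioi (0 : ℝ), ENNReal.ofReal (x ^ (-α) * |f x|)

/-- `f ∈ C^α_+`. -/
def MemHolder (α : ℝ) (f : ℝ → ℝ) : Prop :=
  ContinuousOn f (Ioi 0) ∧ holderNorm α f < ⊤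

/-- `f ∈ L_ρ`: `f` is measurable on `(0, ∞)` and `∫_0^∞ |f(x)| (1 + x)^(-1 - 2ρ) dx < ∞`. -/
def MemL (ρ : ℝ) (f : ℝ → ℝ) : Prop :=
  IntegrableOn (fun x => f x / (1 + x) ^ (1 + 2 * ρ)) (Ioi 0)

/-- `v = v(x, t)` is a classical solution of `v_tt - Δ_lam v = 0` in `(0, ∞) × (0, ∞)` with
`v(x, 0) = f(x)` for each `x > 0`, the latter as a limit when `t → 0⁺`. -/
structure IsClassicalSolution (lam : ℝ) (f : ℝ → ℝ) (v : ℝ → ℝ → ℝ) : Prop where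
  contDiffOn : ContDiffOn ℝ 2 (fun p : ℝ × ℝ => v p.1 p.2) (Ioi 0 ×ˢ Ioi 0)
  equation : ∀ x > 0, ∀ t > 0,
    iteratedDeriv 2 (fun t' => v x t') t - besselOp lam (fun x' => v x' t) x = 0
  boundary : ∀ x > 0, Tendsto (fun t => v x t) (𝓝[>] 0) (𝓝 (f x))

end

end BesselHarmonic

namespace BesselHarmonic

/-! Conjugation by `x^lam` turns `Δ_lam` into `-d²/dx² - (2 lam/x) d/dx`, the radial Laplacian in
"dimension" `2 lam + 1`, and `u` plays the cosine of the angle between two points at radii `x` and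
`y`. Poisson's integral for `I_{lam-1/2}` makes this literal: the heat kernel is an average of
Gaussians `exp(-(x²+y²-2xyu)/(4s))` against `(1-u²)^(lam-1) du` (`heatKernel_eq`). Subordination and
Fubini then give (`poisson_eq`) `P_t f(x) = (2 lam/π) t x^lam ∬ y^lam f(y) (1-u²)^(lam-1)
D^(-(lam+1)) du dy` with `D = x²+y²+t²-2xyu`.

Such potentials, with an extra factor `(yu)^j` and a general exponent `-β`, are closed under
differentiation (`hasFDerivAt_potential`), which yields smoothness. After differentiating twice, the
equation reduces to one linear relation between potentials (`potential_relation`): the angular part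
of the Laplacian is the `u`-derivative of a function vanishing at `u = ±1`
(`integral_angular_divergence`).

For the boundary value, `y^lam` replaces the constant 1: it is invariant under heat and Poisson
semigroups (`heat_rpow`, `poisson_rpow`). Subtracting a multiple of it reduces to `f x = 0`. The
positive kernel then gives a small contribution near `x` by comparison with `y^lam`, and `O(t)` away
from `x` (`poissonKernel_le`). -/

/-- The squared distance `x² + y² + t² - 2xyu` between `p = (x, t)` and the point with polar
coordinates `q = (y, u)`, where `u` is the cosine of the angle. -/
noncomputable def polarDistSq (p q : ℝ × ℝ) : ℝ :=
  p.1 ^ 2 + q.1 ^ 2 + p.2 ^ 2 - 2 * p.1 * q.1 * q.2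

/-- The potential `∫ G(y, u) (y u)^j (x² + y² + t² - 2xyu)^(-β) dμ(y, u)`. -/
noncomputable def potential (μ : Measure (ℝ × ℝ)) (G : ℝ × ℝ → ℝ) (β : ℝ) (j : ℕ) (p : ℝ × ℝ) : ℝ :=
  ∫ q, G q * ((q.1 * q.2) ^ j * polarDistSq p q ^ (-β)) ∂μ

/-! ### Elementary bounds for the squared distance -/

lemma measurable_polarDistSq (p : ℝ × ℝ) : Measurable (polarDistSq p) := by
  unfold polarDistSq; fun_prop

lemma sq_abs_sub_abs_add_sq_le_polarDistSq {p q : ℝ × ℝ} (hq : |q.2| ≤ 1) :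
    (|p.1| - |q.1|) ^ 2 + p.2 ^ 2 ≤ polarDistSq p q := by
  have h1 : p.1 * q.1 * q.2 ≤ |p.1| * |q.1| := by
    calc p.1 * q.1 * q.2 ≤ |p.1 * q.1 * q.2| := le_abs_self _
      _ = |p.1| * |q.1| * |q.2| := by rw [abs_mul, abs_mul]
      _ ≤ |p.1| * |q.1| * 1 := by gcongr
      _ = _ := mul_one _
  have h2 := sq_abs p.1
  have h3 := sq_abs q.1
  unfold polarDistSq
  nlinarith

/-- Since `y² ≤ 2(|x|-|y|)² + 2x²`, one has `1 + y² ≤ 2D + (1+2X)`, and `D ≥ τ` absorbs the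
constant. Here `τ` comes from `t` when differentiating and from the distance to the diagonal in the
boundary estimate. -/
lemma one_add_sq_le_polarDistSq {p q : ℝ × ℝ} {X τ : ℝ} (hτ : 0 < τ) (hX : p.1 ^ 2 ≤ X)
    (hD : τ ≤ polarDistSq p q) (hq : |q.2| ≤ 1) :
    1 + q.1 ^ 2 ≤ (2 + (1 + 2 * X) / τ) * polarDistSq p q := by
  have h0 : 0 ≤ X := (sq_nonneg _).trans hX
  have h1 := sq_abs_sub_abs_add_sq_le_polarDistSq (p := p) hq
  have h2 : 1 + 2 * X ≤ (1 + 2 * X) / τ * polarDistSq p q := by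
    rw [div_mul_eq_mul_div, le_div_iff₀ hτ]
    gcongr
  have h3 := sq_abs p.1
  have h4 := sq_abs q.1
  nlinarith [sq_nonneg (2 * |p.1| - |q.1|), sq_nonneg p.2]

/-- The factor `(yu)^j` costs `j/2` powers of `1 + y²` and `D^(-β)` gains `β` of them. This is the
source of the condition `b + j/2 ≤ β` used throughout. -/
lemma abs_potential_term_le {y u D K b β : ℝ} {j : ℕ} (hu : |u| ≤ 1) (hK : 0 < K)
    (hD : 1 + y ^ 2 ≤ K * D) (hb : 0 ≤ b) (hβ : b + j / 2 ≤ β) :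
    |(y * u) ^ j * D ^ (-β)| ≤ K ^ β * (1 + y ^ 2) ^ (-b) := by
  have h1 : 1 ≤ 1 + y ^ 2 := by nlinarith [sq_nonneg y]
  have h0 : 0 < 1 + y ^ 2 := by linarith
  have hD0 : 0 < D := by
    by_contra h
    nlinarith
  have hβ0 : 0 ≤ β := by
    have : (0 : ℝ) ≤ j := Nat.cast_nonneg j
    linarith
  have e1 : |(y * u) ^ j| ≤ (1 + y ^ 2) ^ ((j : ℝ) / 2) := by
    rw [abs_pow, abs_mul]
    calc (|y| * |u|) ^ j ≤ (|y| * 1) ^ j := by gcongr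
      _ = ((|y|) ^ (2 : ℝ)) ^ ((j : ℝ) / 2) := by
        rw [← Real.rpow_mul (abs_nonneg _), mul_one, ← Real.rpow_natCast]
        congr 1; ring
      _ ≤ _ := by
        gcongr
        rw [Real.rpow_two, sq_abs]; linarith
  have e2 : |D ^ (-β)| ≤ K ^ β * (1 + y ^ 2) ^ (-β) := by
    rw [abs_of_pos (Real.rpow_pos_of_pos hD0 _)]
    calc D ^ (-β) = K ^ β * (K * D) ^ (-β) := by
          rw [Real.mul_rpow hK.le hD0.le, ← mul_assoc, ← Real.rpow_add hK]; simp
      _ ≤ K ^ β * (1 + y ^ 2) ^ (-β) := by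
        gcongr K ^ β * ?_
        exact Real.rpow_le_rpow_of_nonpos h0 hD (by linarith)
  calc |(y * u) ^ j * D ^ (-β)| = |(y * u) ^ j| * |D ^ (-β)| := abs_mul _ _
    _ ≤ (1 + y ^ 2) ^ ((j : ℝ) / 2) * (K ^ β * (1 + y ^ 2) ^ (-β)) := by gcongr
    _ = K ^ β * (1 + y ^ 2) ^ ((j : ℝ) / 2 - β) := by
      rw [sub_eq_add_neg, Real.rpow_add h0]; ring
    _ ≤ _ := by
      gcongr K ^ β * ?_
      exact Real.rpow_le_rpow_of_exponent_le h1 (by linarith)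

/-! ### Differentiation of potentials -/

section Potential

variable {μ : Measure (ℝ × ℝ)} {G : ℝ × ℝ → ℝ} {b : ℝ}

lemma aestronglyMeasurable_of_integrable_weighted
    (hG : Integrable (fun q => G q * (1 + q.1 ^ 2) ^ (-b)) μ) : AEStronglyMeasurable G μ := by
  have : AEStronglyMeasurable (fun q : ℝ × ℝ => (1 + q.1 ^ 2) ^ b) μ := by
    apply Measurable.aestronglyMeasurable; fun_prop
  refine (hG.aestronglyMeasurable.mul this).congr (Eventually.of_forall fun q => ?_)
  have : 0 < 1 + q.1 ^ 2 := by positivity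
  simp [mul_assoc, ← Real.rpow_add this]

lemma aestronglyMeasurable_potential_term
    (hG : Integrable (fun q => G q * (1 + q.1 ^ 2) ^ (-b)) μ) (β : ℝ) (j : ℕ) (p : ℝ × ℝ) :
    AEStronglyMeasurable (fun q => G q * ((q.1 * q.2) ^ j * polarDistSq p q ^ (-β))) μ := by
  refine (aestronglyMeasurable_of_integrable_weighted hG).mul (Measurable.aestronglyMeasurable ?_)
  have := measurable_polarDistSq p
  fun_prop

lemma integrable_potential_term (hμ : ∀ᵐ q ∂μ, |q.2| ≤ 1) (hb : 0 ≤ b)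
    (hG : Integrable (fun q => G q * (1 + q.1 ^ 2) ^ (-b)) μ) {β : ℝ} {j : ℕ}
    (hβ : b + j / 2 ≤ β) {p : ℝ × ℝ} (hp : 0 < p.2) :
    Integrable (fun q => G q * ((q.1 * q.2) ^ j * polarDistSq p q ^ (-β))) μ := by
  set K := 2 + (1 + 2 * p.1 ^ 2) / p.2 ^ 2
  have hK : 0 < K := by positivity
  refine (hG.norm.const_mul (K ^ β)).mono' (aestronglyMeasurable_potential_term hG β j p) ?_
  filter_upwards [hμ] with q hq
  have h1 := sq_abs_sub_abs_add_sq_le_polarDistSq (p := p) hq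
  have h2 := abs_potential_term_le hq hK (one_add_sq_le_polarDistSq (p := p) (τ := p.2 ^ 2)
    (by positivity) le_rfl (by nlinarith [sq_nonneg (|p.1| - |q.1|)]) hq) hb hβ
  rw [Real.norm_eq_abs, Real.norm_eq_abs, abs_mul (G q), abs_mul (G q),
    abs_of_nonneg (a := (1 + q.1 ^ 2) ^ (-b)) (by positivity)]
  calc |G q| * _ ≤ |G q| * (K ^ β * (1 + q.1 ^ 2) ^ (-b)) := by gcongr
    _ = _ := by ring

lemma hasFDerivAt_potential_term (g : ℝ) (β : ℝ) (j : ℕ) {p q : ℝ × ℝ}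
    (hD : 0 < polarDistSq p q) :
    HasFDerivAt (fun p => g * ((q.1 * q.2) ^ j * polarDistSq p q ^ (-β)))
      ((g * ((q.1 * q.2) ^ j * polarDistSq p q ^ (-(β + 1)))) •
          ((-2 * β) • (p.1 • ContinuousLinearMap.fst ℝ ℝ ℝ + p.2 • ContinuousLinearMap.snd ℝ ℝ ℝ))
        + (g * ((q.1 * q.2) ^ (j + 1) * polarDistSq p q ^ (-(β + 1)))) •
          ((2 * β) • ContinuousLinearMap.fst ℝ ℝ ℝ)) p := by
  have h1 : HasFDerivAt (fun p : ℝ × ℝ => p.1) (ContinuousLinearMap.fst ℝ ℝ ℝ) p := hasFDerivAt_fst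
  have h2 : HasFDerivAt (fun p : ℝ × ℝ => p.2) (ContinuousLinearMap.snd ℝ ℝ ℝ) p := hasFDerivAt_snd
  have h3 : HasFDerivAt (fun p => polarDistSq p q)
      ((2 * (p.1 - q.1 * q.2)) • ContinuousLinearMap.fst ℝ ℝ ℝ
        + (2 * p.2) • ContinuousLinearMap.snd ℝ ℝ ℝ) p := by
    have := ((((h1.pow 2).add_const (q.1 ^ 2)).add (h2.pow 2))).sub
      (((h1.const_mul 2).mul_const q.1).mul_const q.2)
    refine this.congr_fderiv ?_
    ext <;> simp <;> ring
  refine (((h3.rpow_const (p := -β) (Or.inl hD.ne')).const_mul ((q.1 * q.2) ^ j)).const_mul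
    g).congr_fderiv ?_
  rw [show -β - 1 = -(β + 1) by ring]
  ext <;> (simp; ring)

/-- A derivative raises `β` by 1 and `j` by at most 1, so `b + j/2 ≤ β` survives and the lemma can
be iterated. -/
lemma hasFDerivAt_potential (hμ : ∀ᵐ q ∂μ, |q.2| ≤ 1) (hb : 0 ≤ b)
    (hG : Integrable (fun q => G q * (1 + q.1 ^ 2) ^ (-b)) μ) {β : ℝ} {j : ℕ}
    (hβ : b + j / 2 ≤ β) {p : ℝ × ℝ} (hp : 0 < p.2) :
    HasFDerivAt (potential μ G β j)
      (potential μ G (β + 1) j p •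
          ((-2 * β) • (p.1 • ContinuousLinearMap.fst ℝ ℝ ℝ + p.2 • ContinuousLinearMap.snd ℝ ℝ ℝ))
        + potential μ G (β + 1) (j + 1) p • ((2 * β) • ContinuousLinearMap.fst ℝ ℝ ℝ)) p := by
  have hβ1 : b + j / 2 ≤ β + 1 := by linarith
  have hβ2 : b + ((j + 1 : ℕ) : ℝ) / 2 ≤ β + 1 := by push_cast; linarith
  set L : ℝ × ℝ → (ℝ × ℝ →L[ℝ] ℝ) := fun p =>
    (-2 * β) • (p.1 • ContinuousLinearMap.fst ℝ ℝ ℝ + p.2 • ContinuousLinearMap.snd ℝ ℝ ℝ) with hL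
  set M : ℝ × ℝ →L[ℝ] ℝ := (2 * β) • ContinuousLinearMap.fst ℝ ℝ ℝ
  have hLc : Continuous L := by fun_prop
  -- On this neighbourhood `x²` is bounded and `t` stays away from 0, so a single `K` serves all its
  -- points; the last condition bounds the coefficient of the derivative.
  set s : Set (ℝ × ℝ) := {r | r.1 ^ 2 < p.1 ^ 2 + 1 ∧ p.2 / 2 < r.2 ∧ ‖L r‖ < ‖L p‖ + 1} with hs
  have hsn : s ∈ 𝓝 p := by
    apply IsOpen.mem_nhds
    · simp only [hs, ofPred_and]
      refine (isOpen_lt ?_ ?_).inter ((isOpen_lt ?_ ?_).inter (isOpen_lt ?_ ?_)) <;> fun_prop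
    · exact ⟨by simp, by simp; linarith, by simp⟩
  set K := 2 + (1 + 2 * (p.1 ^ 2 + 1)) / (p.2 / 2) ^ 2
  have hK : 0 < K := by positivity
  have hlow : ∀ r ∈ s, ∀ q : ℝ × ℝ, |q.2| ≤ 1 →
      1 + q.1 ^ 2 ≤ K * polarDistSq r q ∧ 0 < polarDistSq r q := by
    intro r hr q hq
    have h1 := sq_abs_sub_abs_add_sq_le_polarDistSq (p := r) hq
    have h2 : (p.2 / 2) ^ 2 ≤ polarDistSq r q := by
      have := hr.2.1
      nlinarith [sq_nonneg (|r.1| - |q.1|)]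
    exact ⟨one_add_sq_le_polarDistSq (by positivity) hr.1.le h2 hq, lt_of_lt_of_le (by positivity) h2⟩
  have key := hasFDerivAt_integral_of_dominated_of_fderiv_le (μ := μ) (𝕜 := ℝ) (s := s) (x₀ := p)
    (F := fun p q => G q * ((q.1 * q.2) ^ j * polarDistSq p q ^ (-β)))
    (F' := fun p q => (G q * ((q.1 * q.2) ^ j * polarDistSq p q ^ (-(β + 1)))) • L p
      + (G q * ((q.1 * q.2) ^ (j + 1) * polarDistSq p q ^ (-(β + 1)))) • M)
    (bound := fun q => ‖G q * (1 + q.1 ^ 2) ^ (-b)‖ * (K ^ (β + 1) * (‖L p‖ + 1 + ‖M‖)))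
    hsn (Eventually.of_forall fun r => aestronglyMeasurable_potential_term hG β j r)
    (integrable_potential_term hμ hb hG hβ hp)
    (((aestronglyMeasurable_potential_term hG _ _ p).smul_const _).add
      ((aestronglyMeasurable_potential_term hG _ _ p).smul_const _)) ?_
    (hG.norm.mul_const _) ?_
  · refine key.congr_fderiv ?_
    rw [integral_add ((integrable_potential_term hμ hb hG hβ1 hp).smul_const _)
      ((integrable_potential_term hμ hb hG hβ2 hp).smul_const _), integral_smul_const,
      integral_smul_const]
    rfl
  · filter_upwards [hμ] with q hq r hr
    obtain ⟨h1, -⟩ := hlow r hr q hq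
    have e1 := abs_potential_term_le hq hK h1 hb hβ1
    have e2 := abs_potential_term_le hq hK h1 hb hβ2
    have e3 := hr.2.2
    calc _ ≤ _ := norm_add_le _ _
      _ ≤ |G q| * (K ^ (β + 1) * (1 + q.1 ^ 2) ^ (-b)) * (‖L p‖ + 1)
          + |G q| * (K ^ (β + 1) * (1 + q.1 ^ 2) ^ (-b)) * ‖M‖ := by
        rw [norm_smul _ (L r), norm_smul _ M, Real.norm_eq_abs, Real.norm_eq_abs, abs_mul (G q),
          abs_mul (G q)]
        gcongr
      _ = _ := by
        rw [Real.norm_eq_abs, abs_mul, abs_of_nonneg (a := (1 + q.1 ^ 2) ^ (-b)) (by positivity)]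
        ring
  · filter_upwards [hμ] with q hq r hr
    exact hasFDerivAt_potential_term (G q) β j (hlow r hr q hq).2

lemma contDiffOn_potential (hμ : ∀ᵐ q ∂μ, |q.2| ≤ 1) (hb : 0 ≤ b)
    (hG : Integrable (fun q => G q * (1 + q.1 ^ 2) ^ (-b)) μ) (n : ℕ) {β : ℝ} {j : ℕ}
    (hβ : b + j / 2 ≤ β) :
    ContDiffOn ℝ n (potential μ G β j) {p | 0 < p.2} := by
  have hopen : IsOpen {p : ℝ × ℝ | 0 < p.2} := isOpen_lt (by fun_prop) (by fun_prop)
  induction n generalizing β j with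
  | zero =>
    exact contDiffOn_zero.2 fun p hp =>
      (hasFDerivAt_potential hμ hb hG hβ hp).continuousAt.continuousWithinAt
  | succ n ih =>
    have h1 : b + j / 2 ≤ β + 1 := by linarith
    have h2 : b + ((j + 1 : ℕ) : ℝ) / 2 ≤ β + 1 := by push_cast; linarith
    push_cast
    rw [contDiffOn_succ_iff_hasFDerivWithinAt_of_uniqueDiffOn hopen.uniqueDiffOn]
    refine ⟨by simp, _, ?_, fun p hp => (hasFDerivAt_potential hμ hb hG hβ hp).hasFDerivWithinAt⟩
    exact ((ih h1).smul (by fun_prop)).add ((ih h2).smul (by fun_prop))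

lemma hasDerivAt_potential_fst (hμ : ∀ᵐ q ∂μ, |q.2| ≤ 1) (hb : 0 ≤ b)
    (hG : Integrable (fun q => G q * (1 + q.1 ^ 2) ^ (-b)) μ) {β : ℝ} {j : ℕ}
    (hβ : b + j / 2 ≤ β) (x : ℝ) {t : ℝ} (ht : 0 < t) :
    HasDerivAt (fun x => potential μ G β j (x, t))
      (-2 * β * (x * potential μ G (β + 1) j (x, t) - potential μ G (β + 1) (j + 1) (x, t))) x := by
  have h := (hasFDerivAt_potential hμ hb hG hβ (p := (x, t)) ht).comp_hasDerivAt x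
    ((hasDerivAt_id x).prodMk (hasDerivAt_const x t))
  refine h.congr_deriv ?_
  simp; ring

lemma hasDerivAt_potential_snd (hμ : ∀ᵐ q ∂μ, |q.2| ≤ 1) (hb : 0 ≤ b)
    (hG : Integrable (fun q => G q * (1 + q.1 ^ 2) ^ (-b)) μ) {β : ℝ} {j : ℕ}
    (hβ : b + j / 2 ≤ β) (x : ℝ) {t : ℝ} (ht : 0 < t) :
    HasDerivAt (fun t => potential μ G β j (x, t))
      (-2 * β * (t * potential μ G (β + 1) j (x, t))) t := by
  have h := (hasFDerivAt_potential hμ hb hG hβ (p := (x, t)) ht).comp_hasDerivAt t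
    ((hasDerivAt_const t x).prodMk (hasDerivAt_id t))
  refine h.congr_deriv ?_
  simp; ring

end Potential

/-! ### The substitution `s = c/r` and inverse Gamma integrals -/

section InverseSubstitution

variable {c : ℝ}

lemma image_const_div_Ioi (hc : 0 < c) : (fun r : ℝ => c / r) '' Ioi 0 = Ioi 0 := by
  ext s
  simp only [mem_image, mem_Ioi]
  constructor
  · rintro ⟨r, hr, rfl⟩; positivity
  · intro hs
    exact ⟨c / s, by positivity, by field_simp⟩

lemma hasDerivWithinAt_const_div_Ioi (c : ℝ) :
    ∀ r ∈ Ioi (0 : ℝ), HasDerivWithinAt (fun r => c / r) (-c / r ^ 2) (Ioi 0) r := by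
  intro r hr
  have hr0 : r ≠ 0 := (mem_Ioi.1 hr).ne'
  have : HasDerivAt (fun r => c / r) _ r := (hasDerivAt_const r c).div (hasDerivAt_id' r) hr0
  exact (this.congr_deriv (by simp)).hasDerivWithinAt

lemma injOn_const_div_Ioi (hc : 0 < c) : InjOn (fun r : ℝ => c / r) (Ioi 0) := by
  intro r hr s hs h
  have hr0 : r ≠ 0 := (mem_Ioi.1 hr).ne'
  have hs0 : s ≠ 0 := (mem_Ioi.1 hs).ne'
  simp only at h
  field_simp at h
  exact h.symm

lemma integrableOn_Ioi_const_div_iff (hc : 0 < c) (g : ℝ → ℝ) :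
    IntegrableOn g (Ioi 0) ↔ IntegrableOn (fun r => c / r ^ 2 * g (c / r)) (Ioi 0) := by
  have := integrableOn_image_iff_integrableOn_abs_deriv_smul measurableSet_Ioi
    (hasDerivWithinAt_const_div_Ioi c) (injOn_const_div_Ioi hc) g
  rw [image_const_div_Ioi hc] at this
  rw [this]
  refine integrableOn_congr_fun (fun r hr => ?_) measurableSet_Ioi
  simp only [smul_eq_mul, abs_div, abs_neg, abs_of_pos hc, abs_pow, sq_abs]

lemma integral_Ioi_const_div (hc : 0 < c) (g : ℝ → ℝ) :
    ∫ s in Ioi 0, g s = ∫ r in Ioi 0, c / r ^ 2 * g (c / r) := by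
  have := integral_image_eq_integral_abs_deriv_smul measurableSet_Ioi
    (hasDerivWithinAt_const_div_Ioi c) (injOn_const_div_Ioi hc) g
  rw [image_const_div_Ioi hc] at this
  rw [this]
  refine setIntegral_congr_fun measurableSet_Ioi (fun r hr => ?_)
  simp only [smul_eq_mul, abs_div, abs_neg, abs_of_pos hc, abs_pow, sq_abs]

variable {a D : ℝ}

lemma inverse_gamma_integrand (hD : 0 < D) {r : ℝ} (hr : r ∈ Ioi (0 : ℝ)) :
    (D / 4) / r ^ 2 * ((D / 4 / r) ^ (-a - 1) * Real.exp (-D / (4 * (D / 4 / r))))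
      = (D / 4) ^ (-a) * (Real.exp (-r) * r ^ (a - 1)) := by
  have hr : 0 < r := hr
  have h1 : -D / (4 * (D / 4 / r)) = -r := by field_simp
  have hD4 : 0 < D / 4 := by positivity
  rw [h1, Real.div_rpow hD4.le hr.le, Real.rpow_sub hD4, Real.rpow_sub hr, Real.rpow_sub hr,
    Real.rpow_neg hr.le a, Real.rpow_one, Real.rpow_one]
  have : r ^ a ≠ 0 := (Real.rpow_pos_of_pos hr a).ne'
  field_simp

lemma integrableOn_rpow_mul_exp_neg_div (ha : 0 < a) (hD : 0 < D) :
    IntegrableOn (fun s => s ^ (-a - 1) * Real.exp (-D / (4 * s))) (Ioi 0) := by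
  rw [integrableOn_Ioi_const_div_iff (c := D / 4) (by positivity)]
  rw [integrableOn_congr_fun (fun r hr => inverse_gamma_integrand hD hr) measurableSet_Ioi]
  exact (Real.GammaIntegral_convergent ha).const_mul _

lemma integral_rpow_mul_exp_neg_div (ha : 0 < a) (hD : 0 < D) :
    ∫ s in Ioi 0, s ^ (-a - 1) * Real.exp (-D / (4 * s)) = (D / 4) ^ (-a) * Real.Gamma a := by
  rw [integral_Ioi_const_div (c := D / 4) (by positivity),
    setIntegral_congr_fun measurableSet_Ioi (fun r hr => inverse_gamma_integrand hD hr),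
    integral_const_mul, Real.Gamma_eq_integral ha]

end InverseSubstitution

/-! ### Beta integrals on `(0, 1)` and `(-1, 1)` -/

section Beta

variable {a b : ℝ}

/-- Read off from the fact that the Beta density has total mass 1. -/
lemma lintegral_beta (ha : 0 < a) (hb : 0 < b) :
    ∫⁻ x in Ioo (0 : ℝ) 1, ENNReal.ofReal (x ^ (a - 1) * (1 - x) ^ (b - 1))
      = ENNReal.ofReal (ProbabilityTheory.beta a b) := by
  have h0 := ProbabilityTheory.beta_pos ha hb
  have h := ProbabilityTheory.lintegral_betaPDF_eq_one ha hb
  rw [ProbabilityTheory.lintegral_betaPDF] at h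
  simp_rw [mul_assoc, ENNReal.ofReal_mul (one_div_pos.2 h0).le] at h
  rw [lintegral_const_mul _ (by fun_prop), one_div, ENNReal.ofReal_inv_of_pos h0,
    mul_comm, ← div_eq_mul_inv, ENNReal.div_eq_one_iff] at h
  · exact h
  · simpa using h0
  · simp

lemma integrableOn_beta (ha : 0 < a) (hb : 0 < b) :
    IntegrableOn (fun x : ℝ => x ^ (a - 1) * (1 - x) ^ (b - 1)) (Ioo 0 1) := by
  refine (lintegral_ofReal_ne_top_iff_integrable (Measurable.aestronglyMeasurable (by fun_prop))
    ?_).1 (by rw [lintegral_beta ha hb]; simp)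
  filter_upwards [ae_restrict_mem measurableSet_Ioo] with x hx
  have h1 := hx.1
  have h2 : 0 < 1 - x := by linarith [hx.2]
  simp only [Pi.zero_apply]
  positivity

lemma integral_beta (ha : 0 < a) (hb : 0 < b) :
    ∫ x in Ioo (0 : ℝ) 1, x ^ (a - 1) * (1 - x) ^ (b - 1) = ProbabilityTheory.beta a b := by
  rw [integral_eq_lintegral_of_nonneg_ae _ (Measurable.aestronglyMeasurable (by fun_prop)),
    lintegral_beta ha hb, ENNReal.toReal_ofReal (ProbabilityTheory.beta_pos ha hb).le]
  filter_upwards [ae_restrict_mem measurableSet_Ioo] with x hx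
  have h1 := hx.1
  have h2 : 0 < 1 - x := by linarith [hx.2]
  simp only [Pi.zero_apply]
  positivity

lemma image_sq_Ioo : (fun u : ℝ => u ^ 2) '' Ioo 0 1 = Ioo 0 1 := by
  ext s
  simp only [mem_image, mem_Ioo]
  constructor
  · rintro ⟨r, ⟨h0, h1⟩, rfl⟩
    exact ⟨by positivity, by nlinarith⟩
  · rintro ⟨h0, h1⟩
    exact ⟨√s, ⟨Real.sqrt_pos.2 h0, by rw [Real.sqrt_lt' one_pos]; simpa⟩, Real.sq_sqrt h0.le⟩

lemma injOn_sq_Ioo : InjOn (fun u : ℝ => u ^ 2) (Ioo 0 1) := by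
  intro r hr s hs h
  exact (pow_left_inj₀ hr.1.le hs.1.le two_ne_zero).1 h

lemma hasDerivWithinAt_sq_Ioo :
    ∀ u ∈ Ioo (0 : ℝ) 1, HasDerivWithinAt (fun u => u ^ 2) (2 * u) (Ioo 0 1) u := by
  intro u _
  simpa using (hasDerivAt_pow 2 u).hasDerivWithinAt (s := Ioo 0 1)

lemma even_beta_integrand (k : ℕ) {u : ℝ} (hu : u ∈ Ioo (0 : ℝ) 1) :
    |2 * u| • ((u ^ 2) ^ ((k : ℝ) + 1 / 2 - 1) * (1 - u ^ 2) ^ (b - 1))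
      = 2 * (u ^ (2 * k) * (1 - u ^ 2) ^ (b - 1)) := by
  have h0 : 0 < u := hu.1
  have h : u * (u ^ 2) ^ ((k : ℝ) + 1 / 2 - 1) = u ^ (2 * k) := by
    rw [← Real.rpow_natCast u 2, ← Real.rpow_mul h0.le, ← Real.rpow_natCast u (2 * k)]
    nth_rewrite 1 [← Real.rpow_one u]
    rw [← Real.rpow_add h0]
    congr 1; push_cast; ring
  rw [smul_eq_mul, abs_of_pos (by positivity), ← h]
  ring

lemma integrableOn_even_beta (hb : 0 < b) (k : ℕ) :
    IntegrableOn (fun u : ℝ => u ^ (2 * k) * (1 - u ^ 2) ^ (b - 1)) (Ioo 0 1) := by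
  have h := integrableOn_beta (a := (k : ℝ) + 1 / 2) (by positivity) hb
  rw [← image_sq_Ioo, integrableOn_image_iff_integrableOn_abs_deriv_smul measurableSet_Ioo
    hasDerivWithinAt_sq_Ioo injOn_sq_Ioo,
    integrableOn_congr_fun (fun r hr => even_beta_integrand k hr) measurableSet_Ioo] at h
  have h2 := h.const_mul (1 / 2)
  simpa [IntegrableOn, ← mul_assoc] using h2

lemma integral_even_beta (hb : 0 < b) (k : ℕ) :
    ∫ u in Ioo (0 : ℝ) 1, u ^ (2 * k) * (1 - u ^ 2) ^ (b - 1)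
      = 1 / 2 * ProbabilityTheory.beta (k + 1 / 2) b := by
  rw [← integral_beta (by positivity) hb]
  nth_rewrite 2 [← image_sq_Ioo]
  rw [integral_image_eq_integral_abs_deriv_smul measurableSet_Ioo
    hasDerivWithinAt_sq_Ioo injOn_sq_Ioo,
    setIntegral_congr_fun measurableSet_Ioo (fun r hr => even_beta_integrand k hr),
    integral_const_mul]
  ring

lemma integrableOn_Ioo_neg_one_one {h : ℝ → ℝ} (h1 : IntegrableOn h (Ioo 0 1))
    (h2 : IntegrableOn (fun u => h (-u)) (Ioo 0 1)) :
    IntegrableOn h (Ioo (-1) 1) := by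
  have i1 : IntervalIntegrable h volume 0 1 :=
    (intervalIntegrable_iff_integrableOn_Ioo_of_le zero_le_one).2 h1
  have i2 : IntervalIntegrable (fun u => h (-u)) volume 0 1 :=
    (intervalIntegrable_iff_integrableOn_Ioo_of_le zero_le_one).2 h2
  have i3 := ((IntervalIntegrable.iff_comp_neg).1 i2).symm
  simp only [neg_neg, neg_zero] at i3
  exact (intervalIntegrable_iff_integrableOn_Ioo_of_le (by norm_num)).1 (i3.trans i1)

lemma integral_Ioo_neg_one_one {h : ℝ → ℝ} (h1 : IntegrableOn h (Ioo 0 1))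
    (h2 : IntegrableOn (fun u => h (-u)) (Ioo 0 1)) :
    ∫ u in Ioo (-1) 1, h u = ∫ u in Ioo 0 1, (h u + h (-u)) := by
  have i1 : IntervalIntegrable h volume 0 1 :=
    (intervalIntegrable_iff_integrableOn_Ioo_of_le zero_le_one).2 h1
  have i2 : IntervalIntegrable (fun u => h (-u)) volume 0 1 :=
    (intervalIntegrable_iff_integrableOn_Ioo_of_le zero_le_one).2 h2
  have i3 := ((IntervalIntegrable.iff_comp_neg).1 i2).symm
  simp only [neg_neg, neg_zero] at i3
  rw [integral_add h1 h2, ← integral_Ioc_eq_integral_Ioo, ← integral_Ioc_eq_integral_Ioo,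
    ← integral_Ioc_eq_integral_Ioo, ← intervalIntegral.integral_of_le (by norm_num),
    ← intervalIntegral.integral_of_le (by norm_num),
    ← intervalIntegral.integral_of_le (by norm_num),
    ← intervalIntegral.integral_add_adjacent_intervals i3 i1, intervalIntegral.integral_comp_neg]
  simp [add_comm]

lemma integrableOn_one_sub_sq_rpow (hb : 0 < b) :
    IntegrableOn (fun u : ℝ => (1 - u ^ 2) ^ (b - 1)) (Ioo (-1) 1) := by
  have := integrableOn_even_beta hb 0
  simp only [mul_zero, pow_zero, one_mul] at this
  exact integrableOn_Ioo_neg_one_one this (by simpa using this)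

lemma integrableOn_continuousOn_mul_one_sub_sq_rpow (hb : 0 < b) {h : ℝ → ℝ}
    (hh : ContinuousOn h (Icc (-1) 1)) :
    IntegrableOn (fun u : ℝ => h u * (1 - u ^ 2) ^ (b - 1)) (Ioo (-1) 1) := by
  obtain ⟨C, hC⟩ := isCompact_Icc.exists_bound_of_continuousOn hh
  refine (integrableOn_one_sub_sq_rpow hb).bdd_mul (c := C)
    ((hh.mono Ioo_subset_Icc_self).aestronglyMeasurable measurableSet_Ioo) ?_
  filter_upwards [ae_restrict_mem measurableSet_Ioo] with u hu
  exact hC u (Ioo_subset_Icc_self hu)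

end Beta

/-! ### Poisson's integral for the Bessel function -/

section Bessel

/-- Converts the factor `Γ(k+1/2)` of the Beta integral into the `(2k)!` of the series of `cosh`. -/
lemma gamma_nat_add_half_mul (k : ℕ) :
    Real.Gamma (k + 1 / 2) * (4 ^ k * k.factorial) = (2 * k).factorial * √Real.pi := by
  induction k with
  | zero => simp [Real.Gamma_one_half_eq, -one_div]
  | succ k ih =>
    have h : ((k + 1 : ℕ) : ℝ) + 1 / 2 = (k + 1 / 2 : ℝ) + 1 := by push_cast; ring
    rw [h, Real.Gamma_add_one (by positivity), show 2 * (k + 1) = 2 * k + 1 + 1 by ring,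
      Nat.factorial_succ, Nat.factorial_succ, Nat.factorial_succ]
    push_cast
    linear_combination (4 * (k + 1 / 2) * (k + 1) : ℝ) * ih

/-- The series of the Bessel function as a Poisson integral. -/
lemma hasSum_besselI {lam z : ℝ} (hlam : 0 < lam) (hz : 0 < z) :
    HasSum (fun k : ℕ => (z / 2) ^ (2 * (k : ℝ) + (lam - 1 / 2)) /
        ((k.factorial : ℝ) * Real.Gamma ((k : ℝ) + (lam - 1 / 2) + 1)))
      ((z / 2) ^ (lam - 1 / 2) / (√Real.pi * Real.Gamma lam) *
        ∫ u in Ioo (-1 : ℝ) 1, Real.exp (z * u) * (1 - u ^ 2) ^ (lam - 1)) := by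
  have hw : IntegrableOn (fun u : ℝ => Real.exp (z * u) * (1 - u ^ 2) ^ (lam - 1)) (Ioo (-1) 1) :=
    integrableOn_continuousOn_mul_one_sub_sq_rpow hlam (by fun_prop)
  have hw' : IntegrableOn (fun u : ℝ => Real.exp (z * -u) * (1 - (-u) ^ 2) ^ (lam - 1))
      (Ioo (-1) 1) := by
    simpa using integrableOn_continuousOn_mul_one_sub_sq_rpow hlam
      (h := fun u => Real.exp (-(z * u))) (by fun_prop)
  have hsub : Ioo (0 : ℝ) 1 ⊆ Ioo (-1) 1 := Ioo_subset_Ioo_left (by norm_num)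
  -- The weight is even, so only the even part of the exponential contributes; this leaves only the
  -- powers `z^(2k)` of the Bessel series.
  have hcosh : ∫ u in Ioo (-1 : ℝ) 1, Real.exp (z * u) * (1 - u ^ 2) ^ (lam - 1)
      = ∫ u in Ioo (0 : ℝ) 1, 2 * (Real.cosh (z * u) * (1 - u ^ 2) ^ (lam - 1)) := by
    rw [integral_Ioo_neg_one_one (hw.mono_set hsub) (hw'.mono_set hsub)]
    congr 1 with u
    rw [Real.cosh_eq, neg_sq, mul_neg]
    ring
  have hint : IntegrableOn (fun u : ℝ => Real.cosh (z * u) * (1 - u ^ 2) ^ (lam - 1)) (Ioo 0 1) :=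
    (integrableOn_continuousOn_mul_one_sub_sq_rpow hlam
      (Real.continuous_cosh.comp (continuous_const_mul z)).continuousOn).mono_set hsub
  have hpos : ∀ u ∈ Ioo (0 : ℝ) 1, 0 < 1 - u ^ 2 := fun u hu => by nlinarith [hu.1, hu.2]
  have hsum : HasSum (fun k : ℕ => ∫ u in Ioo (0 : ℝ) 1,
      (z * u) ^ (2 * k) / (2 * k).factorial * (1 - u ^ 2) ^ (lam - 1))
      (∫ u in Ioo (0 : ℝ) 1, Real.cosh (z * u) * (1 - u ^ 2) ^ (lam - 1)) := by
    -- All terms are nonnegative on `(0, 1)`, so the series serves as its own dominating series.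
    refine hasSum_integral_of_dominated_convergence
      (fun k u => (z * u) ^ (2 * k) / (2 * k).factorial * (1 - u ^ 2) ^ (lam - 1))
      (fun k => Measurable.aestronglyMeasurable (by fun_prop)) (fun k => ?_) ?_ ?_ ?_
    · filter_upwards [ae_restrict_mem measurableSet_Ioo] with u hu
      have := hpos u hu
      have := hu.1
      rw [Real.norm_of_nonneg (by positivity)]
    · exact Eventually.of_forall fun u => ((Real.hasSum_cosh (z * u)).mul_right _).summable
    · refine hint.congr (Eventually.of_forall fun u => ?_)
      exact ((Real.hasSum_cosh (z * u)).mul_right _).tsum_eq.symm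
    · exact Eventually.of_forall fun u => (Real.hasSum_cosh (z * u)).mul_right _
  rw [hcosh, integral_const_mul, ← mul_assoc]
  refine (congrArg (fun g => HasSum g _) (funext fun k => ?_)).mpr (hsum.mul_left _)
  have hk : (fun u : ℝ => (z * u) ^ (2 * k) / (2 * k).factorial * (1 - u ^ 2) ^ (lam - 1))
      = fun u => z ^ (2 * k) / (2 * k).factorial * (u ^ (2 * k) * (1 - u ^ 2) ^ (lam - 1)) := by
    ext u; rw [mul_pow]; ring
  have hz2 : 0 < z / 2 := by positivity
  have hG := Real.Gamma_pos_of_pos hlam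
  have hG2 : 0 < Real.Gamma ((k : ℝ) + 1 / 2 + lam) := Real.Gamma_pos_of_pos (by positivity)
  rw [hk, integral_const_mul, integral_even_beta hlam, ProbabilityTheory.beta,
    show (k : ℝ) + (lam - 1 / 2) + 1 = k + 1 / 2 + lam by ring, Real.rpow_add hz2,
    eq_div_of_mul_eq (by positivity) (gamma_nat_add_half_mul k),
    show 2 * (k : ℝ) = ((2 * k : ℕ) : ℝ) by push_cast; ring, Real.rpow_natCast, div_pow,
    pow_mul 2 2 k]
  norm_num
  field_simp

lemma besselI_eq_integral {lam z : ℝ} (hlam : 0 < lam) (hz : 0 < z) :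
    besselI (lam - 1 / 2) z = (z / 2) ^ (lam - 1 / 2) / (√Real.pi * Real.Gamma lam) *
        ∫ u in Ioo (-1 : ℝ) 1, Real.exp (z * u) * (1 - u ^ 2) ^ (lam - 1) :=
  (hasSum_besselI hlam hz).tsum_eq

end Bessel

/-- With `n = ⌈a⌉`, `z^a ≤ (1+z)^n ≤ n! e^(1+z)`; passing to `1 + z ≥ 1` is what permits rounding
the exponent up. -/
lemma exists_exp_neg_le_mul_rpow_neg {a : ℝ} (ha : 0 ≤ a) :
    ∃ C > 0, ∀ z > 0, Real.exp (-z) ≤ C * z ^ (-a) := by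
  refine ⟨(⌈a⌉₊.factorial : ℝ) * Real.exp 1, by positivity, fun z hz => ?_⟩
  have h1 : z ^ a ≤ (⌈a⌉₊.factorial : ℝ) * Real.exp (1 + z) := by
    calc z ^ a ≤ (1 + z) ^ a := by gcongr; linarith
      _ ≤ (1 + z) ^ ((⌈a⌉₊ : ℕ) : ℝ) := by
        gcongr
        · linarith
        · exact Nat.le_ceil a
      _ = (1 + z) ^ ⌈a⌉₊ := Real.rpow_natCast _ _
      _ ≤ _ := by
        have := Real.pow_div_factorial_le_exp (1 + z) (by positivity) ⌈a⌉₊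
        rwa [div_le_iff₀ (by positivity), mul_comm] at this
  rw [Real.exp_neg, Real.rpow_neg hz.le, ← div_eq_mul_inv, le_div_iff₀ (by positivity), inv_mul_eq_div,
    div_le_iff₀ (Real.exp_pos _), mul_assoc, ← Real.exp_add]
  exact h1

/-! ### Fubini for the subordination integral -/

section Subordination

variable {Q : Type*} [MeasurableSpace Q] {μ : Measure Q} [SFinite μ] {a : ℝ} {D G : Q → ℝ}

/-- By Tonelli: integrating the positive factor in `s` first leaves a constant times `|G| D^(-a)`,
integrable by assumption. -/
lemma integrable_prod_rpow_mul_exp_neg_div (ha : 0 < a) (hD : Measurable D)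
    (hpos : ∀ᵐ q ∂μ, 0 < D q) (hG : Integrable (fun q => G q * D q ^ (-a)) μ) :
    Integrable (fun z : ℝ × Q => z.1 ^ (-a - 1) * Real.exp (-D z.2 / (4 * z.1)) * G z.2)
      ((volume.restrict (Ioi 0)).prod μ) := by
  have hGm : AEStronglyMeasurable G μ := by
    have h1 : AEStronglyMeasurable (fun q => D q ^ a) μ :=
      (Measurable.aestronglyMeasurable (by fun_prop))
    refine (hG.aestronglyMeasurable.mul h1).congr ?_
    filter_upwards [hpos] with q hq
    simp [mul_assoc, ← Real.rpow_add hq]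
  have hm : AEStronglyMeasurable
      (fun z : ℝ × Q => z.1 ^ (-a - 1) * Real.exp (-D z.2 / (4 * z.1)) * G z.2)
      ((volume.restrict (Ioi 0)).prod μ) :=
    (Measurable.aestronglyMeasurable (by fun_prop)).mul hGm.comp_snd
  rw [integrable_prod_iff' hm]
  constructor
  · filter_upwards [hpos] with q hq
    exact (integrableOn_rpow_mul_exp_neg_div ha hq).mul_const _
  · refine (hG.norm.const_mul ((1 / 4) ^ (-a) * Real.Gamma a)).congr ?_
    filter_upwards [hpos] with q hq
    have h1 : ∀ s ∈ Ioi (0 : ℝ), ‖s ^ (-a - 1) * Real.exp (-D q / (4 * s)) * G q‖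
        = s ^ (-a - 1) * Real.exp (-D q / (4 * s)) * ‖G q‖ := by
      intro s hs
      have hs : 0 < s := hs
      rw [norm_mul, Real.norm_of_nonneg (by positivity)]
    rw [setIntegral_congr_fun measurableSet_Ioi h1, integral_mul_const,
      integral_rpow_mul_exp_neg_div ha hq, norm_mul, Real.norm_of_nonneg (r := D q ^ (-a))
      (by positivity), div_eq_mul_one_div (D q), Real.mul_rpow hq.le (by norm_num)]
    ring

lemma integral_integral_rpow_mul_exp_neg_div (ha : 0 < a) (hD : Measurable D)
    (hpos : ∀ᵐ q ∂μ, 0 < D q) (hG : Integrable (fun q => G q * D q ^ (-a)) μ) :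
    ∫ s in Ioi (0 : ℝ), ∫ q, s ^ (-a - 1) * Real.exp (-D q / (4 * s)) * G q ∂μ
      = 4 ^ a * Real.Gamma a * ∫ q, G q * D q ^ (-a) ∂μ := by
  rw [integral_integral_swap (integrable_prod_rpow_mul_exp_neg_div ha hD hpos hG),
    ← integral_const_mul]
  refine integral_congr_ae ?_
  filter_upwards [hpos] with q hq
  rw [integral_mul_const, integral_rpow_mul_exp_neg_div ha hq, Real.div_rpow hq.le (by norm_num),
    Real.rpow_neg (by norm_num : (0 : ℝ) ≤ 4)]
  field_simp

end Subordination

/-! ### The semigroups as integrals over the half-strip -/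

/-- The measure `dy du` on `(0, ∞) × (-1, 1)`. -/
noncomputable def halfStrip : Measure (ℝ × ℝ) :=
  (volume.restrict (Ioi 0)).prod (volume.restrict (Ioo (-1) 1))

instance : SFinite halfStrip := by unfold halfStrip; infer_instance

/-- The density `y^lam f(y) (1 - u²)^(lam - 1)` of the potential that represents `P_t f`. -/
noncomputable def density (lam : ℝ) (f : ℝ → ℝ) (q : ℝ × ℝ) : ℝ :=
  q.1 ^ lam * f q.1 * (1 - q.2 ^ 2) ^ (lam - 1)

/-- The weighted integrability condition under which `P_t f` is defined. -/
def PoissonIntegrable (lam : ℝ) (f : ℝ → ℝ) : Prop :=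
  IntegrableOn (fun y => y ^ lam * f y * (1 + y ^ 2) ^ (-(lam + 1))) (Ioi 0)

lemma ae_halfStrip : ∀ᵐ q ∂halfStrip, 0 < q.1 ∧ |q.2| < 1 := by
  have : halfStrip = volume.restrict (Ioi (0 : ℝ) ×ˢ Ioo (-1 : ℝ) 1) := by
    rw [halfStrip, Measure.prod_restrict]; rfl
  rw [this]
  filter_upwards [ae_restrict_mem (measurableSet_Ioi.prod measurableSet_Ioo)] with q hq
  exact ⟨hq.1, abs_lt.2 hq.2⟩

lemma ae_halfStrip_abs_snd_le : ∀ᵐ q ∂halfStrip, |q.2| ≤ 1 :=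
  ae_halfStrip.mono fun _ h => h.2.le

variable {lam : ℝ} {f : ℝ → ℝ}

lemma integrable_density (hlam : 0 < lam) (hf : PoissonIntegrable lam f) :
    Integrable (fun q => density lam f q * (1 + q.1 ^ 2) ^ (-(lam + 1))) halfStrip := by
  refine (Integrable.mul_prod hf (integrableOn_one_sub_sq_rpow hlam)).congr
    (Eventually.of_forall fun q => ?_)
  simp only [density]
  ring

lemma polarDistSq_eq_add (x t : ℝ) (q : ℝ × ℝ) :
    polarDistSq (x, t) q = polarDistSq (x, 0) q + t ^ 2 := by
  simp only [polarDistSq]; ring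

lemma polarDistSq_pos {x t : ℝ} (ht : 0 < t) {q : ℝ × ℝ} (hq : |q.2| ≤ 1) :
    0 < polarDistSq (x, t) q := by
  have := sq_abs_sub_abs_add_sq_le_polarDistSq (p := (x, t)) hq
  have h2 : 0 < t ^ 2 := by positivity
  simp only at this
  nlinarith [sq_nonneg (|x| - |q.1|)]

/-- The exponential `exp(xyu/(2s))` of Poisson's integral completes `exp(-(x²+y²)/(4s))` to a
Gaussian in the distance, and the powers of `xy` and `s` combine. -/
lemma heatKernel_eq (hlam : 0 < lam) {s x y : ℝ} (hs : 0 < s) (hx : 0 < x) (hy : 0 < y) :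
    heatKernel lam s x y = 2 / (√Real.pi * Real.Gamma lam) * (x * y) ^ lam *
      (4 * s) ^ (-lam - 1 / 2) * ∫ u in Ioo (-1 : ℝ) 1,
        Real.exp (-polarDistSq (x, 0) (y, u) / (4 * s)) * (1 - u ^ 2) ^ (lam - 1) := by
  have hxy : 0 < x * y := by positivity
  have h4s : 0 < 4 * s := by positivity
  have h1 : ∀ u : ℝ, Real.exp (-polarDistSq (x, 0) (y, u) / (4 * s)) * (1 - u ^ 2) ^ (lam - 1)
      = Real.exp (-(x ^ 2 + y ^ 2) / (4 * s)) *
        (Real.exp (x * y / (2 * s) * u) * (1 - u ^ 2) ^ (lam - 1)) := by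
    intro u
    rw [← mul_assoc, ← Real.exp_add]
    congr 2
    simp only [polarDistSq]
    field_simp
    ring
  simp_rw [h1]
  rw [integral_const_mul, heatKernel, besselI_eq_integral hlam (by positivity),
    show x * y / (2 * s) / 2 = x * y / (4 * s) by field_simp; norm_num,
    Real.div_rpow hxy.le h4s.le, Real.rpow_sub hxy, Real.rpow_sub h4s, Real.rpow_sub h4s,
    Real.rpow_neg h4s.le, ← Real.sqrt_eq_rpow, ← Real.sqrt_eq_rpow]
  have h2 : √(4 * s) * √(4 * s) = 4 * s := Real.mul_self_sqrt h4s.le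
  have h3 := Real.sqrt_pos.2 h4s
  have h4 := Real.sqrt_pos.2 hxy
  have h5 := Real.Gamma_pos_of_pos hlam
  have h6 : 2 * s = √(4 * s) * √(4 * s) / 2 := by rw [h2]; ring
  rw [h6]
  field_simp

lemma heatKernel_nonneg (hlam : 0 < lam) {s x y : ℝ} (hs : 0 < s) (hx : 0 < x) (hy : 0 < y) :
    0 ≤ heatKernel lam s x y := by
  rw [heatKernel_eq hlam hs hx hy]
  have h5 := Real.Gamma_pos_of_pos hlam
  refine mul_nonneg (by positivity) (setIntegral_nonneg measurableSet_Ioo fun u hu => ?_)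
  have : 0 < 1 - u ^ 2 := by nlinarith [hu.1, hu.2]
  positivity

lemma integrable_exp_neg_mul_density (hlam : 0 < lam) (hf : PoissonIntegrable lam f) (x : ℝ)
    {s : ℝ} (hs : 0 < s) :
    Integrable (fun q => Real.exp (-polarDistSq (x, 0) q / (4 * s)) * density lam f q)
      halfStrip := by
  have hG := integrable_density hlam hf
  obtain ⟨C, hC, hexp⟩ := exists_exp_neg_le_mul_rpow_neg (a := lam + 1) (by positivity)
  -- At height 0 the squared distance can be arbitrarily small, so the comparison is made at height
  -- 1, at the price of the constant factor `exp(1/(4s))`.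
  have hI := integrable_potential_term (j := 0) (β := lam + 1) ae_halfStrip_abs_snd_le
    (by positivity) hG (by simp) (p := (x, 1)) one_pos
  refine (hI.norm.const_mul (C * (1 / (4 * s)) ^ (-(lam + 1)) * Real.exp (1 / (4 * s)))).mono' ?_ ?_
  · refine (Measurable.aestronglyMeasurable ?_).mul (aestronglyMeasurable_of_integrable_weighted hG)
    have := measurable_polarDistSq (x, 0)
    fun_prop
  · filter_upwards [ae_halfStrip_abs_snd_le] with q hq
    have hD : 0 < polarDistSq (x, 1) q := polarDistSq_pos one_pos hq
    have h1 := hexp (polarDistSq (x, 1) q * (1 / (4 * s))) (by positivity)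
    rw [Real.mul_rpow hD.le (by positivity)] at h1
    have h2 : Real.exp (-polarDistSq (x, 0) q / (4 * s))
        = Real.exp (-(polarDistSq (x, 1) q * (1 / (4 * s)))) * Real.exp (1 / (4 * s)) := by
      rw [← Real.exp_add, polarDistSq_eq_add x 1]
      congr 1; ring
    rw [norm_mul, h2, Real.norm_of_nonneg (r := _ * _) (by positivity), pow_zero, one_mul, norm_mul,
      Real.norm_of_nonneg (r := _ ^ _) (by positivity)]
    calc _ ≤ (C * (polarDistSq (x, 1) q ^ (-(lam + 1)) * (1 / (4 * s)) ^ (-(lam + 1))))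
          * Real.exp (1 / (4 * s)) * ‖density lam f q‖ := by gcongr
      _ = _ := by ring

lemma heatKernel_mul_eq (hlam : 0 < lam) {s x y : ℝ} (hs : 0 < s) (hx : 0 < x) (hy : 0 < y) :
    heatKernel lam s x y * f y = 2 / (√Real.pi * Real.Gamma lam) * x ^ lam *
      (4 * s) ^ (-lam - 1 / 2) * ∫ u in Ioo (-1 : ℝ) 1,
        Real.exp (-polarDistSq (x, 0) (y, u) / (4 * s)) * density lam f (y, u) := by
  have : ∀ u : ℝ, Real.exp (-polarDistSq (x, 0) (y, u) / (4 * s)) * density lam f (y, u)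
      = y ^ lam * f y *
        (Real.exp (-polarDistSq (x, 0) (y, u) / (4 * s)) * (1 - u ^ 2) ^ (lam - 1)) := by
    intro u; simp only [density]; ring
  simp_rw [this]
  rw [integral_const_mul, heatKernel_eq hlam hs hx hy, Real.mul_rpow hx.le hy.le]
  ring

lemma integrableOn_heatKernel_mul (hlam : 0 < lam) (hf : PoissonIntegrable lam f) {s x : ℝ}
    (hs : 0 < s) (hx : 0 < x) :
    IntegrableOn (fun y => heatKernel lam s x y * f y) (Ioi 0) := by
  rw [integrableOn_congr_fun (s := Ioi 0) (fun y hy => heatKernel_mul_eq hlam hs hx hy) measurableSet_Ioi]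
  exact (integrable_exp_neg_mul_density hlam hf x hs).integral_prod_left.const_mul _

lemma heat_eq (hlam : 0 < lam) (hf : PoissonIntegrable lam f) {s x : ℝ}
    (hs : 0 < s) (hx : 0 < x) :
    heat lam s f x = 2 / (√Real.pi * Real.Gamma lam) * x ^ lam * (4 * s) ^ (-lam - 1 / 2) *
      ∫ q, Real.exp (-polarDistSq (x, 0) q / (4 * s)) * density lam f q ∂halfStrip := by
  rw [heat, setIntegral_congr_fun measurableSet_Ioi
    (fun y hy => heatKernel_mul_eq hlam hs hx hy), integral_const_mul, halfStrip,
    integral_prod _ (integrable_exp_neg_mul_density hlam hf x hs)]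

/-- The power of `s` and the Gaussian factors in the subordination integrand. -/
lemma subordination_factor_mul {s : ℝ} (hs : 0 < s) (x t : ℝ) (q : ℝ × ℝ) :
    Real.exp (-t ^ 2 / (4 * s)) / s ^ (3 / 2 : ℝ) *
        ((4 * s) ^ (-lam - 1 / 2) * Real.exp (-polarDistSq (x, 0) q / (4 * s)))
      = 4 ^ (-lam - 1 / 2) * (s ^ (-(lam + 1) - 1) * Real.exp (-polarDistSq (x, t) q / (4 * s))) := by
  have h1 : Real.exp (-polarDistSq (x, t) q / (4 * s))
      = Real.exp (-t ^ 2 / (4 * s)) * Real.exp (-polarDistSq (x, 0) q / (4 * s)) := by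
    rw [← Real.exp_add, polarDistSq_eq_add x t]; congr 1; ring
  have h2 : s ^ (-(lam + 1) - 1) = s ^ (-lam - 1 / 2) * s ^ (-(3 / 2) : ℝ) := by
    rw [← Real.rpow_add hs]; congr 1; ring
  rw [h1, h2, Real.mul_rpow (by norm_num) hs.le, Real.rpow_neg hs.le (3 / 2)]
  ring

lemma subordination_mul_heat_eq (hlam : 0 < lam) (hf : PoissonIntegrable lam f) {s x : ℝ} (t : ℝ)
    (hs : 0 < s) (hx : 0 < x) :
    Real.exp (-t ^ 2 / (4 * s)) / s ^ (3 / 2 : ℝ) * heat lam s f x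
      = 2 / (√Real.pi * Real.Gamma lam) * x ^ lam * 4 ^ (-lam - 1 / 2) *
        ∫ q, s ^ (-(lam + 1) - 1) * Real.exp (-polarDistSq (x, t) q / (4 * s)) * density lam f q
          ∂halfStrip := by
  rw [heat_eq hlam hf hs hx, ← integral_const_mul, ← integral_const_mul, ← integral_const_mul]
  refine integral_congr_ae (Eventually.of_forall fun q => ?_)
  linear_combination (2 / (√Real.pi * Real.Gamma lam) * x ^ lam * density lam f q) *
    subordination_factor_mul (lam := lam) hs x t q

lemma four_rpow_mul_gamma (hlam : 0 < lam) :
    1 / (2 * √Real.pi) * (2 / (√Real.pi * Real.Gamma lam)) * 4 ^ (-lam - 1 / 2) *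
      (4 ^ (lam + 1) * Real.Gamma (lam + 1)) = 2 * lam / Real.pi := by
  have h1 : (4 : ℝ) ^ (-lam - 1 / 2) * 4 ^ (lam + 1) = 2 := by
    rw [← Real.rpow_add (by norm_num), show -lam - 1 / 2 + (lam + 1) = 1 / 2 by ring,
      ← Real.sqrt_eq_rpow, show (4 : ℝ) = 2 ^ 2 by norm_num]
    exact Real.sqrt_sq (by norm_num)
  have h2 : √Real.pi * √Real.pi = Real.pi := Real.mul_self_sqrt Real.pi_pos.le
  have h3 := Real.Gamma_pos_of_pos hlam
  have h4 := Real.sqrt_pos.2 Real.pi_pos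
  rw [Real.Gamma_add_one hlam.ne']
  calc _ = ((4 : ℝ) ^ (-lam - 1 / 2) * 4 ^ (lam + 1)) * lam / (√Real.pi * √Real.pi) := by
        field_simp
    _ = _ := by rw [h1, h2]

lemma integrable_density_mul_rpow (hlam : 0 < lam) (hf : PoissonIntegrable lam f) (x : ℝ) {t : ℝ}
    (ht : 0 < t) :
    Integrable (fun q => density lam f q * polarDistSq (x, t) q ^ (-(lam + 1))) halfStrip := by
  simpa using integrable_potential_term (j := 0) (β := lam + 1) ae_halfStrip_abs_snd_le
    (by positivity) (integrable_density hlam hf) (by simp) (p := (x, t)) ht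

lemma integrableOn_subordination_mul_heat (hlam : 0 < lam) (hf : PoissonIntegrable lam f) {x t : ℝ}
    (ht : 0 < t) (hx : 0 < x) :
    IntegrableOn (fun s => Real.exp (-t ^ 2 / (4 * s)) / s ^ (3 / 2 : ℝ) * heat lam s f x)
      (Ioi 0) := by
  rw [integrableOn_congr_fun (s := Ioi 0) (fun s hs => subordination_mul_heat_eq hlam hf t hs hx)
    measurableSet_Ioi]
  exact (integrable_prod_rpow_mul_exp_neg_div (a := lam + 1) (by positivity)
    (measurable_polarDistSq (x, t)) (ae_halfStrip_abs_snd_le.mono fun q hq => polarDistSq_pos ht hq)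
    (integrable_density_mul_rpow hlam hf x ht)).integral_prod_left.const_mul _

/-- Since `D` at height `t` is `D` at height 0 plus `t²`, the subordination exponential merges with
the Gaussian, and the `s`-integral is an inverse Gamma integral with exponent `lam + 1`. -/
lemma poisson_eq (hlam : 0 < lam) (hf : PoissonIntegrable lam f) {x t : ℝ}
    (ht : 0 < t) (hx : 0 < x) :
    poisson lam t f x = 2 * lam / Real.pi * t * x ^ lam *
      potential halfStrip (density lam f) (lam + 1) 0 (x, t) := by
  rw [poisson, setIntegral_congr_fun measurableSet_Ioi
    (fun s hs => subordination_mul_heat_eq hlam hf t hs hx), integral_const_mul,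
    integral_integral_rpow_mul_exp_neg_div (by positivity)
    (measurable_polarDistSq (x, t)) (ae_halfStrip_abs_snd_le.mono fun q hq => polarDistSq_pos ht hq)
    (integrable_density_mul_rpow hlam hf x ht), ← four_rpow_mul_gamma hlam]
  simp only [potential, pow_zero, one_mul]
  ring

/-! ### The Poisson kernel -/

section Kernel

lemma integrableOn_one_sub_sq_rpow_mul_polarDistSq (hlam : 0 < lam) (x y : ℝ) {t : ℝ} (ht : 0 < t) :
    IntegrableOn (fun u => (1 - u ^ 2) ^ (lam - 1) * polarDistSq (x, t) (y, u) ^ (-(lam + 1)))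
      (Ioo (-1) 1) := by
  have hm : Measurable fun u => polarDistSq (x, t) (y, u) :=
    (measurable_polarDistSq (x, t)).comp measurable_prodMk_left
  refine (integrableOn_one_sub_sq_rpow hlam).mul_bdd (c := (t ^ 2) ^ (-(lam + 1)))
    (Measurable.aestronglyMeasurable (by fun_prop)) ?_
  filter_upwards [ae_restrict_mem measurableSet_Ioo] with u hu
  have hu : |u| ≤ 1 := (abs_lt.2 hu).le
  have h1 := sq_abs_sub_abs_add_sq_le_polarDistSq (p := (x, t)) (q := (y, u)) hu
  have h2 := polarDistSq_pos (x := x) (q := (y, u)) ht hu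
  rw [Real.norm_of_nonneg (by positivity)]
  refine Real.rpow_le_rpow_of_nonpos (by positivity) ?_ (by linarith)
  simp only at h1
  nlinarith [sq_nonneg (|x| - |y|)]

lemma subordination_mul_heatKernel_eq (hlam : 0 < lam) {s x y : ℝ} (t : ℝ)
    (hs : 0 < s) (hx : 0 < x) (hy : 0 < y) :
    Real.exp (-t ^ 2 / (4 * s)) / s ^ (3 / 2 : ℝ) * heatKernel lam s x y
      = 2 / (√Real.pi * Real.Gamma lam) * (x * y) ^ lam * 4 ^ (-lam - 1 / 2) *
        ∫ u in Ioo (-1 : ℝ) 1, s ^ (-(lam + 1) - 1) *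
          Real.exp (-polarDistSq (x, t) (y, u) / (4 * s)) * (1 - u ^ 2) ^ (lam - 1) := by
  rw [heatKernel_eq hlam hs hx hy, ← integral_const_mul, ← integral_const_mul,
    ← integral_const_mul]
  refine integral_congr_ae (Eventually.of_forall fun u => ?_)
  linear_combination (2 / (√Real.pi * Real.Gamma lam) * (x * y) ^ lam * (1 - u ^ 2) ^ (lam - 1)) *
    subordination_factor_mul (lam := lam) hs x t (y, u)

variable {x y t : ℝ}

lemma integrableOn_subordination_mul_heatKernel (hlam : 0 < lam)
    (ht : 0 < t) (hx : 0 < x) (hy : 0 < y) :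
    IntegrableOn (fun s => Real.exp (-t ^ 2 / (4 * s)) / s ^ (3 / 2 : ℝ) * heatKernel lam s x y)
      (Ioi 0) := by
  rw [integrableOn_congr_fun (s := Ioi 0) (fun s hs => subordination_mul_heatKernel_eq hlam t hs hx hy)
    measurableSet_Ioi]
  refine (integrable_prod_rpow_mul_exp_neg_div (a := lam + 1) (by positivity)
    ((measurable_polarDistSq (x, t)).comp measurable_prodMk_left) ?_
    (integrableOn_one_sub_sq_rpow_mul_polarDistSq hlam x y ht)).integral_prod_left.const_mul _
  filter_upwards [ae_restrict_mem measurableSet_Ioo] with u hu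
  exact polarDistSq_pos ht (abs_lt.2 hu).le

lemma poissonKernel_eq (hlam : 0 < lam) (ht : 0 < t) (hx : 0 < x) (hy : 0 < y) :
    poissonKernel lam t x y = 2 * lam / Real.pi * t * (x * y) ^ lam *
      ∫ u in Ioo (-1 : ℝ) 1,
        (1 - u ^ 2) ^ (lam - 1) * polarDistSq (x, t) (y, u) ^ (-(lam + 1)) := by
  have hpos : ∀ᵐ u ∂volume.restrict (Ioo (-1 : ℝ) 1), 0 < polarDistSq (x, t) (y, u) := by
    filter_upwards [ae_restrict_mem measurableSet_Ioo] with u hu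
    exact polarDistSq_pos ht (abs_lt.2 hu).le
  rw [poissonKernel, setIntegral_congr_fun measurableSet_Ioi
    (fun s hs => subordination_mul_heatKernel_eq hlam t hs hx hy), integral_const_mul,
    integral_integral_rpow_mul_exp_neg_div (D := fun u => polarDistSq (x, t) (y, u)) (by positivity)
    ((measurable_polarDistSq (x, t)).comp measurable_prodMk_left) hpos
    (integrableOn_one_sub_sq_rpow_mul_polarDistSq hlam x y ht), ← four_rpow_mul_gamma hlam]
  ring

lemma poissonKernel_mul_eq (hlam : 0 < lam) (ht : 0 < t) (hx : 0 < x) (hy : 0 < y) :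
    poissonKernel lam t x y * f y = 2 * lam / Real.pi * t * x ^ lam *
      ∫ u in Ioo (-1 : ℝ) 1, density lam f (y, u) * polarDistSq (x, t) (y, u) ^ (-(lam + 1)) := by
  have : ∀ u : ℝ, density lam f (y, u) * polarDistSq (x, t) (y, u) ^ (-(lam + 1))
      = y ^ lam * f y *
        ((1 - u ^ 2) ^ (lam - 1) * polarDistSq (x, t) (y, u) ^ (-(lam + 1))) := by
    intro u; simp only [density]; ring
  simp_rw [this]
  rw [integral_const_mul, poissonKernel_eq hlam ht hx hy, Real.mul_rpow hx.le hy.le]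
  ring

lemma integrableOn_poissonKernel_mul (hlam : 0 < lam) (hf : PoissonIntegrable lam f)
    (ht : 0 < t) (hx : 0 < x) :
    IntegrableOn (fun y => poissonKernel lam t x y * f y) (Ioi 0) := by
  rw [integrableOn_congr_fun (s := Ioi 0) (fun y hy => poissonKernel_mul_eq hlam ht hx hy) measurableSet_Ioi]
  exact (integrable_density_mul_rpow hlam hf x ht).integral_prod_left.const_mul _

/-- Both sides are iterated forms of the same absolutely convergent integral over the half-strip. -/
lemma poisson_eq_integral_poissonKernel (hlam : 0 < lam) (hf : PoissonIntegrable lam f)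
    (ht : 0 < t) (hx : 0 < x) :
    poisson lam t f x = ∫ y in Ioi (0 : ℝ), poissonKernel lam t x y * f y := by
  rw [poisson_eq hlam hf ht hx, setIntegral_congr_fun measurableSet_Ioi
    (fun y hy => poissonKernel_mul_eq hlam ht hx hy), integral_const_mul, potential, halfStrip]
  simp only [pow_zero, one_mul]
  rw [integral_prod _ (integrable_density_mul_rpow hlam hf x ht)]

lemma subordination_change_of_variables (g : ℝ → ℝ) (ht : 0 < t) {r : ℝ} (hr : 0 < r) :
    t ^ 2 / 4 / r ^ 2 * (Real.exp (-t ^ 2 / (4 * (t ^ 2 / 4 / r))) / (t ^ 2 / 4 / r) ^ (3 / 2 : ℝ)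
        * g (t ^ 2 / 4 / r))
      = 2 / t * (Real.exp (-r) / r ^ (1 / 2 : ℝ) * g (t ^ 2 / (4 * r))) := by
  have h1 : -t ^ 2 / (4 * (t ^ 2 / 4 / r)) = -r := by field_simp
  have h2 : (t ^ 2 / 4) ^ (3 / 2 : ℝ) = t ^ 3 / 8 := by
    rw [show t ^ 2 / 4 = (t / 2) ^ (2 : ℝ) by rw [Real.rpow_two]; ring,
      ← Real.rpow_mul (by positivity), show (2 : ℝ) * (3 / 2) = (3 : ℕ) by norm_num,
      Real.rpow_natCast]
    ring
  have h3 : r ^ (3 / 2 : ℝ) = r * r ^ (1 / 2 : ℝ) := by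
    nth_rewrite 2 [← Real.rpow_one r]
    rw [← Real.rpow_add hr]; norm_num
  rw [h1, Real.div_rpow (by positivity) hr.le, h2, h3, div_div (t ^ 2) 4 r]
  have h4 : 0 < r ^ (1 / 2 : ℝ) := Real.rpow_pos_of_pos hr _
  have h5 : r ^ (1 / 2 : ℝ) * r ^ (1 / 2 : ℝ) = r := by rw [← Real.rpow_add hr]; norm_num
  -- In terms of `ρ = √r` the identity is rational.
  generalize r ^ (1 / 2 : ℝ) = ρ at h4 h5
  subst h5
  field_simp
  ring

lemma integrableOn_exp_neg_mul_heatKernel (hlam : 0 < lam)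
    (ht : 0 < t) (hx : 0 < x) (hy : 0 < y) :
    IntegrableOn (fun r => Real.exp (-r) / r ^ (1 / 2 : ℝ) * heatKernel lam (t ^ 2 / (4 * r)) x y)
      (Ioi 0) := by
  have h := integrableOn_subordination_mul_heatKernel hlam ht hx hy
  rw [integrableOn_Ioi_const_div_iff (c := t ^ 2 / 4) (by positivity),
    integrableOn_congr_fun (s := Ioi 0) (fun r hr => subordination_change_of_variables
      (fun s => heatKernel lam s x y) ht hr) measurableSet_Ioi] at h
  have h2 := h.const_mul (t / 2)
  simpa [IntegrableOn, ← mul_assoc, ht.ne'] using h2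

lemma poissonKernel_eq_integral_exp_neg (ht : 0 < t) :
    poissonKernel lam t x y = 1 / √Real.pi * ∫ r in Ioi (0 : ℝ),
      Real.exp (-r) / r ^ (1 / 2 : ℝ) * heatKernel lam (t ^ 2 / (4 * r)) x y := by
  rw [poissonKernel, integral_Ioi_const_div (c := t ^ 2 / 4) (by positivity),
    setIntegral_congr_fun measurableSet_Ioi (fun r hr => subordination_change_of_variables
      (fun s => heatKernel lam s x y) ht hr), integral_const_mul, ← mul_assoc]
  congr 1
  field_simp

end Kernel

/-! ### The differential equation -/

lemma iteratedDeriv_two_eq_of_hasDerivAt {g g' : ℝ → ℝ} {g'' x : ℝ}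
    (h : ∀ᶠ y in 𝓝 x, HasDerivAt g (g' y) y) (h2 : HasDerivAt g' g'' x) :
    iteratedDeriv 2 g x = g'' := by
  rw [iteratedDeriv_succ, iteratedDeriv_one]
  have : deriv g =ᶠ[𝓝 x] g' := h.mono fun y hy => hy.deriv
  rw [this.deriv_eq, h2.deriv]

/-- The integrand is the derivative of `(1-u²)^lam D^(-γ)`, which vanishes at `u = ±1` because `lam
> 0`. For `lam < 1` the derivative may blow up at the endpoints, but it is integrable and the
primitive is continuous on the closed interval. -/
lemma integral_angular_divergence (hlam : 0 < lam) (γ x y : ℝ) {t : ℝ} (ht : 0 < t) :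
    ∫ u in Ioo (-1 : ℝ) 1, (-2 * lam * u * polarDistSq (x, t) (y, u) ^ (-γ) +
      2 * γ * x * y * (1 - u ^ 2) * polarDistSq (x, t) (y, u) ^ (-(γ + 1))) *
        (1 - u ^ 2) ^ (lam - 1) = 0 := by
  have hD : ∀ u ∈ Icc (-1 : ℝ) 1, polarDistSq (x, t) (y, u) ≠ 0 := fun u hu =>
    (polarDistSq_pos (q := (y, u)) ht (abs_le.2 hu)).ne'
  have hDc : Continuous fun u => polarDistSq (x, t) (y, u) := by
    simp only [polarDistSq]; fun_prop
  have hpow : ∀ δ : ℝ, ContinuousOn (fun u => polarDistSq (x, t) (y, u) ^ δ) (Icc (-1) 1) :=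
    fun δ => hDc.continuousOn.rpow_const fun u hu => Or.inl (hD u hu)
  have hint := integrableOn_continuousOn_mul_one_sub_sq_rpow hlam
    (h := fun u => -2 * lam * u * polarDistSq (x, t) (y, u) ^ (-γ) +
      2 * γ * x * y * (1 - u ^ 2) * polarDistSq (x, t) (y, u) ^ (-(γ + 1))) (by
        have h1 := hpow (-γ)
        have h2 := hpow (-(γ + 1))
        fun_prop)
  rw [← integral_Ioc_eq_integral_Ioo, ← intervalIntegral.integral_of_le (by norm_num),
    intervalIntegral.integral_eq_sub_of_hasDerivAt_of_le (by norm_num)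
      (f := fun u => (1 - u ^ 2) ^ lam * polarDistSq (x, t) (y, u) ^ (-γ))]
  · simp [hlam.ne']
  · refine ContinuousOn.mul ?_ (hpow _)
    exact ContinuousOn.rpow_const (by fun_prop) fun u _ => Or.inr hlam.le
  · intro u hu
    have hpos : 0 < 1 - u ^ 2 := by nlinarith [hu.1, hu.2]
    have h1 : HasDerivAt (fun u : ℝ => 1 - u ^ 2) (-(2 * u)) u := by
      simpa using (hasDerivAt_pow 2 u).const_sub 1
    have h2 : HasDerivAt (fun u => polarDistSq (x, t) (y, u)) (-(2 * x * y)) u := by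
      have := ((hasDerivAt_id' u).const_mul (2 * x * y)).const_sub (x ^ 2 + y ^ 2 + t ^ 2)
      simpa [polarDistSq] using this
    have h3 := (h1.rpow_const (p := lam) (Or.inl hpos.ne')).mul
      (h2.rpow_const (p := -γ) (Or.inl (hD u (Ioo_subset_Icc_self hu))))
    refine h3.congr_deriv ?_
    have h4 : (1 - u ^ 2) ^ lam = (1 - u ^ 2) ^ (lam - 1) * (1 - u ^ 2) := by
      rw [Real.rpow_sub_one hpos.ne']; field_simp
    rw [h4, show -γ - 1 = -(γ + 1) by ring]
    ring
  · exact (intervalIntegrable_iff_integrableOn_Ioo_of_le (by norm_num)).2 hint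

lemma integral_linear_combination {Q : Type*} [MeasurableSpace Q] {μ : Measure Q}
    {A B C D E : Q → ℝ} (hA : Integrable A μ) (hB : Integrable B μ) (hC : Integrable C μ)
    (hD : Integrable D μ) (hE : Integrable E μ) (a b c d : ℝ) :
    Integrable (fun q => a * A q + b * (B q - c * C q + d * D q - E q)) μ ∧
    ∫ q, (a * A q + b * (B q - c * C q + d * D q - E q)) ∂μ = a * ∫ q, A q ∂μ +
      b * (∫ q, B q ∂μ - c * ∫ q, C q ∂μ + d * ∫ q, D q ∂μ - ∫ q, E q ∂μ) := by
  have h1 : Integrable (fun q => B q - c * C q) μ := hB.sub (hC.const_mul c)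
  have h2 : Integrable (fun q => B q - c * C q + d * D q) μ := h1.add (hD.const_mul d)
  have h3 : Integrable (fun q => B q - c * C q + d * D q - E q) μ := h2.sub hE
  refine ⟨(hA.const_mul a).add (h3.const_mul b), ?_⟩
  rw [integral_add (hA.const_mul a) (h3.const_mul b), integral_const_mul, integral_const_mul,
    integral_sub h2 hE, integral_add h1 (hD.const_mul d), integral_sub hB (hC.const_mul c),
    integral_const_mul, integral_const_mul]

lemma integrable_density_potential_term (hlam : 0 < lam) (hf : PoissonIntegrable lam f) {β : ℝ}
    {j : ℕ} (hβ : lam + 1 + j / 2 ≤ β) (x : ℝ) {t : ℝ} (ht : 0 < t) :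
    Integrable (fun q => density lam f q * ((q.1 * q.2) ^ j * polarDistSq (x, t) q ^ (-β)))
      halfStrip :=
  integrable_potential_term ae_halfStrip_abs_snd_le (by positivity) (integrable_density hlam hf)
    hβ (p := (x, t)) ht

/-- The relation between potentials that expresses that the angular part of the Laplacian
integrates to zero. -/
lemma potential_relation (hlam : 0 < lam) (hf : PoissonIntegrable lam f) (x : ℝ) {t : ℝ}
    (ht : 0 < t) :
    -2 * lam * potential halfStrip (density lam f) (lam + 1 + 1) 1 (x, t) +
      2 * (lam + 1 + 1) * x * (potential halfStrip (density lam f) (lam + 1 + 1) 0 (x, t) -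
        (x ^ 2 + t ^ 2) * potential halfStrip (density lam f) (lam + 1 + 1 + 1) 0 (x, t) +
        2 * x * potential halfStrip (density lam f) (lam + 1 + 1 + 1) 1 (x, t) -
        potential halfStrip (density lam f) (lam + 1 + 1 + 1) 2 (x, t)) = 0 := by
  have i11 := integrable_density_potential_term hlam hf (β := lam + 1 + 1) (j := 1)
    (by norm_num) x ht
  have i10 := integrable_density_potential_term hlam hf (β := lam + 1 + 1) (j := 0)
    (by norm_num) x ht
  have i20 := integrable_density_potential_term hlam hf (β := lam + 1 + 1 + 1) (j := 0)
    (by norm_num; linarith) x ht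
  have i21 := integrable_density_potential_term hlam hf (β := lam + 1 + 1 + 1) (j := 1)
    (by norm_num; linarith) x ht
  have i22 := integrable_density_potential_term hlam hf (β := lam + 1 + 1 + 1) (j := 2)
    (by norm_num) x ht
  obtain ⟨hint, key⟩ := integral_linear_combination i11 i10 i20 i21 i22 (-2 * lam)
    (2 * (lam + 1 + 1) * x) (x ^ 2 + t ^ 2) (2 * x)
  simp only [potential]
  rw [← key]
  rw [halfStrip] at hint ⊢
  rw [integral_prod _ hint]
  refine (integral_congr_ae ?_).trans (integral_zero _ _)
  refine Eventually.of_forall fun y => ?_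
  have h := integral_angular_divergence hlam (lam + 1 + 1) x y ht
  have h0 : ∀ c : ℝ, c * ∫ u in Ioo (-1 : ℝ) 1, (-2 * lam * u *
      polarDistSq (x, t) (y, u) ^ (-(lam + 1 + 1)) + 2 * (lam + 1 + 1) * x * y * (1 - u ^ 2) *
      polarDistSq (x, t) (y, u) ^ (-(lam + 1 + 1 + 1))) * (1 - u ^ 2) ^ (lam - 1) = 0 := by
    intro c; rw [h, mul_zero]
  simp only
  -- For fixed `y`, this is the angular identity with `γ = lam + 2` times `y^(lam+1) f(y)`. The
  -- extra `y` produces `y²(1-u²) = y² - (yu)²`, and `y² = D - (x²+t²) + 2x(yu)` rewrites it through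
  -- the available potentials.
  rw [← h0 (y ^ lam * f y * y), ← integral_const_mul]
  refine setIntegral_congr_fun measurableSet_Ioo fun u hu => ?_
  have hD := polarDistSq_pos (x := x) (q := (y, u)) ht (abs_lt.2 hu).le
  have hpow : polarDistSq (x, t) (y, u) ^ (-(lam + 1 + 1)) =
      (x ^ 2 + y ^ 2 + t ^ 2 - 2 * x * y * u) *
        polarDistSq (x, t) (y, u) ^ (-(lam + 1 + 1 + 1)) := by
    rw [show -(lam + 1 + 1 + 1) = -(lam + 1 + 1) - 1 by ring, Real.rpow_sub_one hD.ne']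
    have : x ^ 2 + y ^ 2 + t ^ 2 - 2 * x * y * u = polarDistSq (x, t) (y, u) := rfl
    rw [this]
    field_simp
  simp only [density, hpow]
  ring

section Solution

variable {x t : ℝ}

lemma hasDerivAt_poisson_time (hlam : 0 < lam) (hf : PoissonIntegrable lam f) (hx : 0 < x)
    (ht : 0 < t) :
    HasDerivAt (fun t => poisson lam t f x) (2 * lam / Real.pi * x ^ lam *
      (potential halfStrip (density lam f) (lam + 1) 0 (x, t) -
        2 * (lam + 1) * (t ^ 2 * potential halfStrip (density lam f) (lam + 1 + 1) 0 (x, t)))) t := by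
  have h := ((hasDerivAt_id' t).mul (hasDerivAt_potential_snd ae_halfStrip_abs_snd_le
    (by positivity) (integrable_density hlam hf) (β := lam + 1) (j := 0) (by norm_num) x ht)).const_mul
    (2 * lam / Real.pi * x ^ lam)
  refine (h.congr_deriv (by ring)).congr_of_eventuallyEq ?_
  filter_upwards [lt_mem_nhds ht] with t ht
  rw [poisson_eq hlam hf ht hx]
  simp only [Pi.mul_apply]
  ring

lemma iteratedDeriv_two_poisson_time (hlam : 0 < lam) (hf : PoissonIntegrable lam f) (hx : 0 < x)
    (ht : 0 < t) :
    iteratedDeriv 2 (fun t => poisson lam t f x) t = 2 * lam / Real.pi * x ^ lam * t *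
      (-6 * (lam + 1) * potential halfStrip (density lam f) (lam + 1 + 1) 0 (x, t) +
        4 * (lam + 1) * (lam + 1 + 1) *
          (t ^ 2 * potential halfStrip (density lam f) (lam + 1 + 1 + 1) 0 (x, t))) := by
  refine iteratedDeriv_two_eq_of_hasDerivAt
    ((lt_mem_nhds ht).mono fun t ht => hasDerivAt_poisson_time hlam hf hx ht) ?_
  have h0 := hasDerivAt_potential_snd ae_halfStrip_abs_snd_le
    (by positivity) (integrable_density hlam hf) (β := lam + 1) (j := 0) (by norm_num) x ht
  have h1 := hasDerivAt_potential_snd ae_halfStrip_abs_snd_le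
    (by positivity) (integrable_density hlam hf) (β := lam + 1 + 1) (j := 0) (by norm_num) x ht
  refine ((h0.sub (((hasDerivAt_pow 2 t).mul h1).const_mul (2 * (lam + 1)))).const_mul
    (2 * lam / Real.pi * x ^ lam)).congr_deriv ?_
  norm_num
  ring

lemma hasDerivAt_poisson_space (hlam : 0 < lam) (hf : PoissonIntegrable lam f) (hx : 0 < x)
    (ht : 0 < t) :
    HasDerivAt (fun x => poisson lam t f x) (2 * lam / Real.pi * t *
      (lam * x ^ (lam - 1) * potential halfStrip (density lam f) (lam + 1) 0 (x, t) +
        x ^ lam * (-2 * (lam + 1) *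
          (x * potential halfStrip (density lam f) (lam + 1 + 1) 0 (x, t) -
            potential halfStrip (density lam f) (lam + 1 + 1) 1 (x, t))))) x := by
  have h := ((Real.hasDerivAt_rpow_const (p := lam) (Or.inl hx.ne')).mul
    (hasDerivAt_potential_fst ae_halfStrip_abs_snd_le
    (by positivity) (integrable_density hlam hf) (β := lam + 1) (j := 0) (by norm_num) x ht)).const_mul
    (2 * lam / Real.pi * t)
  refine (h.congr_deriv (by ring)).congr_of_eventuallyEq ?_
  filter_upwards [lt_mem_nhds hx] with x hx
  rw [poisson_eq hlam hf ht hx]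
  simp only [Pi.mul_apply]
  ring

lemma iteratedDeriv_two_poisson_space (hlam : 0 < lam) (hf : PoissonIntegrable lam f) (hx : 0 < x)
    (ht : 0 < t) :
    iteratedDeriv 2 (fun x => poisson lam t f x) x = 2 * lam / Real.pi * t * x ^ lam *
      (lam * (lam - 1) / x ^ 2 * potential halfStrip (density lam f) (lam + 1) 0 (x, t)
        - 4 * lam * (lam + 1) / x *
          (x * potential halfStrip (density lam f) (lam + 1 + 1) 0 (x, t) -
            potential halfStrip (density lam f) (lam + 1 + 1) 1 (x, t))
        - 2 * (lam + 1) * potential halfStrip (density lam f) (lam + 1 + 1) 0 (x, t)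
        + 4 * (lam + 1) * (lam + 1 + 1) *
          (x ^ 2 * potential halfStrip (density lam f) (lam + 1 + 1 + 1) 0 (x, t)
            - 2 * x * potential halfStrip (density lam f) (lam + 1 + 1 + 1) 1 (x, t)
            + potential halfStrip (density lam f) (lam + 1 + 1 + 1) 2 (x, t))) := by
  refine iteratedDeriv_two_eq_of_hasDerivAt
    ((lt_mem_nhds hx).mono fun x hx => hasDerivAt_poisson_space hlam hf hx ht) ?_
  have h0 := hasDerivAt_potential_fst ae_halfStrip_abs_snd_le
    (by positivity) (integrable_density hlam hf) (β := lam + 1) (j := 0) (by norm_num) x ht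
  have h1 := hasDerivAt_potential_fst ae_halfStrip_abs_snd_le
    (by positivity) (integrable_density hlam hf) (β := lam + 1 + 1) (j := 0) (by norm_num) x ht
  have h2 := hasDerivAt_potential_fst ae_halfStrip_abs_snd_le
    (by positivity) (integrable_density hlam hf) (β := lam + 1 + 1) (j := 1) (by norm_num) x ht
  have r0 := Real.hasDerivAt_rpow_const (x := x) (p := lam) (Or.inl hx.ne')
  have r1 := Real.hasDerivAt_rpow_const (x := x) (p := lam - 1) (Or.inl hx.ne')
  refine ((((r1.const_mul lam).mul h0).add (r0.mul ((((hasDerivAt_id' x).mul h1).sub h2).const_mul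
    (-2 * (lam + 1))))).const_mul (2 * lam / Real.pi * t)).congr_deriv ?_
  rw [Real.rpow_sub_one hx.ne', Real.rpow_sub_one hx.ne']
  simp only [Pi.mul_apply, Pi.sub_apply]
  norm_num
  field_simp
  ring

/-- Differentiating `x^lam` twice gives `lam(lam-1)/x²` times the solution and cancels the
zeroth-order term. What remains is `-2(lam+1)/x` times `potential_relation`, up to the common
prefactor. -/
lemma poisson_equation (hlam : 0 < lam) (hf : PoissonIntegrable lam f) (hx : 0 < x)
    (ht : 0 < t) :
    iteratedDeriv 2 (fun t => poisson lam t f x) t -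
      besselOp lam (fun x => poisson lam t f x) x = 0 := by
  have h := potential_relation hlam hf x ht
  rw [besselOp, iteratedDeriv_two_poisson_time hlam hf hx ht,
    iteratedDeriv_two_poisson_space hlam hf hx ht, poisson_eq hlam hf ht hx]
  linear_combination (norm := (field_simp; ring))
    (2 * lam / Real.pi * x ^ lam * t * (-2 * (lam + 1) / x)) * h

end Solution

/-! ### Smoothness and weighted integrability -/

lemma contDiffOn_poisson (hlam : 0 < lam) (hf : PoissonIntegrable lam f) :
    ContDiffOn ℝ 2 (fun p : ℝ × ℝ => poisson lam p.2 f p.1) (Ioi 0 ×ˢ Ioi 0) := by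
  have h : ContDiffOn ℝ 2 (fun p : ℝ × ℝ => 2 * lam / Real.pi * p.2 * p.1 ^ lam *
      potential halfStrip (density lam f) (lam + 1) 0 p) (Ioi 0 ×ˢ Ioi 0) := by
    refine ContDiffOn.mul (ContDiffOn.mul (by fun_prop) ?_) ?_
    · exact contDiffOn_fst.rpow_const_of_ne fun p hp => (mem_Ioi.1 hp.1).ne'
    · exact (contDiffOn_potential ae_halfStrip_abs_snd_le (by positivity)
        (integrable_density hlam hf) 2 (by norm_num)).mono fun p hp => hp.2
  exact h.congr fun p hp => poisson_eq hlam hf hp.2 hp.1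

/-- The quotient of the two weights is bounded by `2^(lam+1)`, because `y^lam ≤ (1+y)^(lam+1)` and
`(1+y)² ≤ 2(1+y²)`. -/
lemma MemL.poissonIntegrable (hlam : 0 < lam) (hf : MemL (lam / 2) f) :
    PoissonIntegrable lam f := by
  have h : IntegrableOn (fun y => (f y / (1 + y) ^ (1 + 2 * (lam / 2))) *
      (y ^ lam * (1 + y) ^ (lam + 1) * (1 + y ^ 2) ^ (-(lam + 1)))) (Ioi 0) := by
    refine Integrable.mul_bdd (c := 2 ^ (lam + 1)) hf
      (Measurable.aestronglyMeasurable (by fun_prop)) ?_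
    filter_upwards [ae_restrict_mem measurableSet_Ioi] with y hy
    have hy : 0 < y := hy
    rw [Real.norm_of_nonneg (by positivity)]
    have h1 : y ^ lam ≤ (1 + y) ^ (lam + 1) := by
      calc y ^ lam ≤ (1 + y) ^ lam := by gcongr; linarith
        _ ≤ _ := Real.rpow_le_rpow_of_exponent_le (by linarith) (by linarith)
    calc _ ≤ (1 + y) ^ (lam + 1) * (1 + y) ^ (lam + 1) * (1 + y ^ 2) ^ (-(lam + 1)) := by gcongr
      _ = ((1 + y) * (1 + y)) ^ (lam + 1) * (1 + y ^ 2) ^ (-(lam + 1)) := by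
        rw [Real.mul_rpow (by positivity) (by positivity)]
      _ ≤ (2 * (1 + y ^ 2)) ^ (lam + 1) * (1 + y ^ 2) ^ (-(lam + 1)) := by
        refine mul_le_mul_of_nonneg_right (Real.rpow_le_rpow (by positivity) ?_ (by linarith))
          (by positivity)
        nlinarith [sq_nonneg (1 - y)]
      _ = 2 ^ (lam + 1) := by
        rw [Real.mul_rpow (by positivity) (by positivity), mul_assoc,
          ← Real.rpow_add (by positivity)]
        simp
  refine h.congr_fun (fun y hy => ?_) measurableSet_Ioi
  have hy : 0 < y := hy
  simp only
  rw [show 1 + 2 * (lam / 2) = lam + 1 by ring]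
  have : 0 < (1 + y) ^ (lam + 1) := by positivity
  field_simp

/-- This is why the weaker condition `PoissonIntegrable` is carried along: `y^lam` is not in `MemL
(lam / 2)`, where the integrand would decay only like `1/y`. -/
lemma poissonIntegrable_rpow (hlam : 0 < lam) : PoissonIntegrable lam (fun y => y ^ lam) := by
  refine Integrable.mono' (integrable_inv_one_add_sq.integrableOn (s := Ioi 0))
    (Measurable.aestronglyMeasurable (by fun_prop)) ?_
  filter_upwards [ae_restrict_mem measurableSet_Ioi] with y hy
  have hy : 0 < y := hy
  have h0 : 0 < 1 + y ^ 2 := by positivity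
  rw [Real.norm_of_nonneg (by positivity), ← Real.mul_rpow hy.le hy.le]
  calc (y * y) ^ lam * (1 + y ^ 2) ^ (-(lam + 1))
      ≤ (1 + y ^ 2) ^ lam * (1 + y ^ 2) ^ (-(lam + 1)) := by gcongr; nlinarith
    _ = (1 + y ^ 2)⁻¹ := by
      rw [← Real.rpow_add h0, ← Real.rpow_neg_one]; congr 1; ring

/-! ### Invariance of `y^lam` -/

section Invariance

variable {s x : ℝ}

/-- The terms of the power series in `y` of `W_s(x, y) y^lam`. -/
noncomputable def heatTerm (lam s x : ℝ) (k : ℕ) (y : ℝ) : ℝ :=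
  2 * x ^ (2 * (k : ℝ) + lam) * (4 * s) ^ (-(2 * (k : ℝ) + lam + 1 / 2)) /
    (k.factorial * Real.Gamma (k + lam + 1 / 2)) * Real.exp (-x ^ 2 / (4 * s)) *
    (y ^ (2 * (k : ℝ) + 2 * lam) * Real.exp (-(1 / (4 * s)) * y ^ (2 : ℝ)))

lemma heatTerm_nonneg (hlam : 0 < lam) (hs : 0 < s) (hx : 0 < x) (k : ℕ) {y : ℝ} (hy : 0 < y) :
    0 ≤ heatTerm lam s x k y := by
  have : 0 < Real.Gamma (k + lam + 1 / 2) := Real.Gamma_pos_of_pos (by positivity)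
  unfold heatTerm
  positivity

lemma hasSum_heatTerm (hlam : 0 < lam) (hs : 0 < s) (hx : 0 < x) {y : ℝ} (hy : 0 < y) :
    HasSum (fun k => heatTerm lam s x k y) (heatKernel lam s x y * y ^ lam) := by
  have hz : 0 < x * y / (2 * s) := by positivity
  have h := (hasSum_besselI hlam hz).mul_left
    (√(x * y) / (2 * s) * Real.exp (-(x ^ 2 + y ^ 2) / (4 * s)) * y ^ lam)
  rw [← besselI_eq_integral hlam hz] at h
  have e : heatKernel lam s x y * y ^ lam = √(x * y) / (2 * s) *
      Real.exp (-(x ^ 2 + y ^ 2) / (4 * s)) * y ^ lam * besselI (lam - 1 / 2) (x * y / (2 * s)) := by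
    rw [heatKernel]; ring
  rw [e]
  refine (congrArg (fun g => HasSum g _) (funext fun k => ?_)).mpr h
  have hxy : 0 < x * y := by positivity
  have h4s : 0 < 4 * s := by positivity
  have e1 : Real.exp (-(x ^ 2 + y ^ 2) / (4 * s))
      = Real.exp (-x ^ 2 / (4 * s)) * Real.exp (-(1 / (4 * s)) * y ^ (2 : ℝ)) := by
    rw [← Real.exp_add, Real.rpow_two]; congr 1; ring
  have e2 : x * y / (2 * s) / 2 = (x * y) / (4 * s) := by field_simp; norm_num
  have e3 : √(x * y) / (2 * s) * (x * y / (4 * s)) ^ (2 * (k : ℝ) + (lam - 1 / 2))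
      = 2 * (x ^ (2 * (k : ℝ) + lam) * y ^ (2 * (k : ℝ) + lam)) *
        (4 * s) ^ (-(2 * (k : ℝ) + lam + 1 / 2)) := by
    rw [Real.sqrt_eq_rpow, Real.div_rpow hxy.le h4s.le, ← Real.mul_rpow hx.le hy.le,
      show 2 * (k : ℝ) + lam = 1 / 2 + (2 * (k : ℝ) + (lam - 1 / 2)) by ring]
    generalize 2 * (k : ℝ) + (lam - 1 / 2) = m
    rw [Real.rpow_add hxy, Real.rpow_neg h4s.le, show 1 / 2 + m + 1 / 2 = 1 + m by ring,
      Real.rpow_add h4s, Real.rpow_one]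
    have : 0 < (4 * s) ^ m := Real.rpow_pos_of_pos h4s _
    field_simp
    norm_num
  have e4 : y ^ (2 * (k : ℝ) + 2 * lam) = y ^ (2 * (k : ℝ) + lam) * y ^ lam := by
    rw [← Real.rpow_add hy]; congr 1; ring
  rw [heatTerm, e1, e2, e4, show (k : ℝ) + (lam - 1 / 2) + 1 = k + lam + 1 / 2 by ring]
  linear_combination (-(Real.exp (-x ^ 2 / (4 * s)) * Real.exp (-(1 / (4 * s)) * y ^ (2 : ℝ))) *
    y ^ lam / (k.factorial * Real.Gamma (k + lam + 1 / 2))) * e3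

lemma integrableOn_heatTerm (hlam : 0 < lam) (hs : 0 < s) (x : ℝ) (k : ℕ) :
    IntegrableOn (heatTerm lam s x k) (Ioi 0) := by
  unfold heatTerm
  refine Integrable.const_mul ?_ _
  have h : (-1 : ℝ) < 2 * (k : ℝ) + 2 * lam := by
    have : (0 : ℝ) ≤ k := Nat.cast_nonneg k
    linarith
  exact integrableOn_rpow_mul_exp_neg_mul_rpow h two_pos (by positivity)

/-- The Gaussian moment equals, up to powers, the Gamma value in the denominator of the Bessel
coefficient; their cancellation leaves the `k`-th term of `exp(x²/(4s))`. -/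
lemma integral_heatTerm (hlam : 0 < lam) (hs : 0 < s) (hx : 0 < x) (k : ℕ) :
    ∫ y in Ioi 0, heatTerm lam s x k y
      = x ^ lam * Real.exp (-x ^ 2 / (4 * s)) * ((x ^ 2 / (4 * s)) ^ k / k.factorial) := by
  have h : (-1 : ℝ) < 2 * (k : ℝ) + 2 * lam := by
    have : (0 : ℝ) ≤ k := Nat.cast_nonneg k
    linarith
  have h4s : 0 < 4 * s := by positivity
  have hG : 0 < Real.Gamma (k + lam + 1 / 2) := Real.Gamma_pos_of_pos (by positivity)
  unfold heatTerm
  rw [integral_const_mul, integral_rpow_mul_exp_neg_mul_rpow two_pos h (by positivity),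
    show (2 * (k : ℝ) + 2 * lam + 1) / 2 = k + lam + 1 / 2 by ring,
    show -(2 * (k : ℝ) + 2 * lam + 1) / 2 = -(k + lam + 1 / 2) by ring, one_div (4 * s),
    Real.inv_rpow h4s.le, ← Real.rpow_neg h4s.le, neg_neg, Real.rpow_add hx, div_pow]
  have e1 : (4 * s) ^ (-(2 * (k : ℝ) + lam + 1 / 2)) * (4 * s) ^ ((k : ℝ) + lam + 1 / 2)
      = ((4 * s) ^ k)⁻¹ := by
    rw [← Real.rpow_add h4s, ← Real.rpow_natCast, ← Real.rpow_neg h4s.le]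
    congr 1; ring
  have e2 : x ^ (2 * (k : ℝ)) = (x ^ 2) ^ k := by
    rw [← pow_mul, ← Real.rpow_natCast]; push_cast; rfl
  rw [e2]
  calc _ = x ^ lam * Real.exp (-x ^ 2 / (4 * s)) * ((x ^ 2) ^ k / k.factorial) *
        ((4 * s) ^ (-(2 * (k : ℝ) + lam + 1 / 2)) * (4 * s) ^ ((k : ℝ) + lam + 1 / 2)) := by
        field_simp
    _ = _ := by rw [e1]; field_simp

/-- The function `y^lam` is invariant under the Bessel heat semigroup. -/
lemma heat_rpow (hlam : 0 < lam) (hs : 0 < s) (hx : 0 < x) :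
    heat lam s (fun y => y ^ lam) x = x ^ lam := by
  have hexp := (NormedSpace.expSeries_div_hasSum_exp (x ^ 2 / (4 * s))).mul_left
    (x ^ lam * Real.exp (-x ^ 2 / (4 * s)))
  rw [← Real.exp_eq_exp_ℝ, mul_assoc, ← Real.exp_add, neg_div, neg_add_cancel, Real.exp_zero,
    mul_one] at hexp
  have hnorm : ∀ k, ∫ y in Ioi 0, ‖heatTerm lam s x k y‖ = ∫ y in Ioi 0, heatTerm lam s x k y :=
    fun k => setIntegral_congr_fun measurableSet_Ioi fun y hy =>
      Real.norm_of_nonneg (heatTerm_nonneg hlam hs hx k hy)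
  have h := hasSum_integral_of_summable_integral_norm (μ := volume.restrict (Ioi 0))
    (F := heatTerm lam s x) (fun k => integrableOn_heatTerm hlam hs x k) (by
      simp_rw [hnorm, integral_heatTerm hlam hs hx, neg_div]
      exact hexp.summable)
  simp_rw [integral_heatTerm hlam hs hx, neg_div] at h
  rw [heat, hexp.unique h]
  exact setIntegral_congr_fun measurableSet_Ioi fun y hy =>
    (hasSum_heatTerm hlam hs hx hy).tsum_eq.symm

/-- By `heat_rpow` only the total mass of the subordination density remains, and it equals 1. -/
lemma poisson_rpow (hlam : 0 < lam) {t : ℝ} (ht : 0 < t) (hx : 0 < x) :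
    poisson lam t (fun y => y ^ lam) x = x ^ lam := by
  have h : ∀ s ∈ Ioi (0 : ℝ), Real.exp (-t ^ 2 / (4 * s)) / s ^ (3 / 2 : ℝ) *
      heat lam s (fun y => y ^ lam) x
      = s ^ (-(1 / 2 : ℝ) - 1) * Real.exp (-t ^ 2 / (4 * s)) * x ^ lam := by
    intro s hs
    have hs : 0 < s := hs
    rw [heat_rpow hlam hs hx, show -(1 / 2 : ℝ) - 1 = -(3 / 2) by norm_num, Real.rpow_neg hs.le]
    ring
  rw [poisson, setIntegral_congr_fun measurableSet_Ioi h, integral_mul_const,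
    integral_rpow_mul_exp_neg_div (by norm_num) (by positivity), Real.Gamma_one_half_eq,
    Real.rpow_neg (by positivity), ← Real.sqrt_eq_rpow,
    show t ^ 2 / 4 = (t / 2) ^ 2 by ring, Real.sqrt_sq (by positivity)]
  have := Real.sqrt_pos.2 Real.pi_pos
  field_simp

end Invariance

/-! ### Boundary values -/

section Boundary

variable {x t y : ℝ}

lemma poissonKernel_nonneg (hlam : 0 < lam) (ht : 0 < t) (hx : 0 < x) (hy : 0 < y) :
    0 ≤ poissonKernel lam t x y := by
  rw [poissonKernel]
  refine mul_nonneg (by positivity) (setIntegral_nonneg measurableSet_Ioi fun s hs => ?_)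
  have hs : 0 < s := hs
  have := heatKernel_nonneg hlam hs hx hy
  positivity

/-- Off the diagonal `D ≥ δ²` independently of `t`, so the only `t` left is the prefactor, while the
decay in `y` matches `PoissonIntegrable`. -/
lemma poissonKernel_le (hlam : 0 < lam) (ht : 0 < t) (hx : 0 < x) (hy : 0 < y) {δ : ℝ}
    (hδ : 0 < δ) (hxy : δ ≤ |y - x|) :
    poissonKernel lam t x y ≤ 2 * lam / Real.pi * t * (x * y) ^ lam *
      ((∫ u in Ioo (-1 : ℝ) 1, (1 - u ^ 2) ^ (lam - 1)) *
        ((2 + (1 + 2 * x ^ 2) / δ ^ 2) ^ (lam + 1) * (1 + y ^ 2) ^ (-(lam + 1)))) := by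
  rw [poissonKernel_eq hlam ht hx hy, ← integral_mul_const]
  have hpi := Real.pi_pos
  refine mul_le_mul_of_nonneg_left ?_ (by positivity)
  refine setIntegral_mono_on (integrableOn_one_sub_sq_rpow_mul_polarDistSq hlam x y ht)
    ((integrableOn_one_sub_sq_rpow hlam).mul_const _) measurableSet_Ioo fun u hu => ?_
  have hu1 : |u| ≤ 1 := (abs_lt.2 hu).le
  have hu2 : 0 < 1 - u ^ 2 := by nlinarith [hu.1, hu.2]
  have h1 := sq_abs_sub_abs_add_sq_le_polarDistSq (p := (x, t)) (q := (y, u)) hu1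
  simp only [abs_of_pos hx, abs_of_pos hy] at h1
  have h2 : δ ^ 2 ≤ polarDistSq (x, t) (y, u) := by
    have : δ ^ 2 ≤ |y - x| ^ 2 := by gcongr
    rw [sq_abs] at this
    nlinarith [sq_nonneg t]
  have h3 := one_add_sq_le_polarDistSq (p := (x, t)) (q := (y, u)) (by positivity) le_rfl h2 hu1
  have h4 := abs_potential_term_le (j := 0) (b := lam + 1) (β := lam + 1) hu1 (by positivity) h3
    (by positivity) (by simp)
  rw [pow_zero, one_mul] at h4
  gcongr
  exact (le_abs_self _).trans h4

/-- If `f(x) = 0`, then `P_t f(x) → 0`. -/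
lemma tendsto_integral_poissonKernel_mul_zero (hlam : 0 < lam) (hf : PoissonIntegrable lam f)
    (hx : 0 < x) (hfx : ContinuousAt f x) (h0 : f x = 0) :
    Tendsto (fun t => ∫ y in Ioi (0 : ℝ), poissonKernel lam t x y * f y) (𝓝[>] 0) (𝓝 0) := by
  rw [Metric.tendsto_nhds]
  intro ε hε
  have hxl : 0 < x ^ lam := by positivity
  -- Chosen so that `η P_t(y^lam)(x) = η x^lam = ε/2`.
  set η := ε / (2 * x ^ lam) with hη
  have hη0 : 0 < η := by positivity
  have hc : ContinuousAt (fun y => |f y| - η * y ^ lam) x :=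
    hfx.abs.sub (continuousAt_const.mul (Real.continuousAt_rpow_const _ _ (Or.inl hx.ne')))
  have hev : ∀ᶠ y in 𝓝 x, |f y| - η * y ^ lam < 0 := by
    refine hc.eventually_lt_const ?_
    simp only [h0, abs_zero]
    nlinarith [mul_pos hη0 hxl]
  obtain ⟨δ, hδ, hnear⟩ := Metric.eventually_nhds_iff.1 hev
  set K := 2 * lam / Real.pi * x ^ lam * ((∫ u in Ioo (-1 : ℝ) 1, (1 - u ^ 2) ^ (lam - 1)) *
    (2 + (1 + 2 * x ^ 2) / δ ^ 2) ^ (lam + 1)) with hK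
  have hK0 : 0 ≤ K := by
    have hpi := Real.pi_pos
    have : 0 ≤ ∫ u in Ioo (-1 : ℝ) 1, (1 - u ^ 2) ^ (lam - 1) :=
      setIntegral_nonneg measurableSet_Ioo fun u hu => by
        have : 0 < 1 - u ^ 2 := by nlinarith [hu.1, hu.2]
        positivity
    positivity
  set M := ∫ y in Ioi (0 : ℝ), ‖y ^ lam * f y * (1 + y ^ 2) ^ (-(lam + 1))‖ with hM
  -- The integrand is dominated everywhere by the sum of the near bound `η P_t(x,y) y^lam` and the
  -- far bound `t K` times the weighted `|f|`, which avoids splitting the integral.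
  have hbound : ∀ t > 0, |∫ y in Ioi (0 : ℝ), poissonKernel lam t x y * f y|
      ≤ ε / 2 + t * (K * M) := by
    intro t ht
    have i1 := (integrableOn_poissonKernel_mul hlam (poissonIntegrable_rpow hlam) ht hx).const_mul η
    have i2 := hf.norm.const_mul (t * K)
    have key := norm_integral_le_of_norm_le (μ := volume.restrict (Ioi 0))
      (f := fun y => poissonKernel lam t x y * f y) (i1.add i2) ?_
    · refine key.trans (le_of_eq ?_)
      simp only [Pi.add_apply]
      rw [integral_add i1 i2, integral_const_mul, integral_const_mul,
        ← poisson_eq_integral_poissonKernel hlam (poissonIntegrable_rpow hlam) ht hx,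
        poisson_rpow hlam ht hx, hM, hη]
      field_simp
    · filter_upwards [ae_restrict_mem measurableSet_Ioi] with y hy
      have hy : 0 < y := hy
      have hP := poissonKernel_nonneg hlam ht hx hy
      have n1 : 0 ≤ η * (poissonKernel lam t x y * y ^ lam) := by positivity
      have n2 : 0 ≤ t * K * ‖y ^ lam * f y * (1 + y ^ 2) ^ (-(lam + 1))‖ := by positivity
      simp only [Pi.add_apply]
      rw [norm_mul, Real.norm_of_nonneg hP, Real.norm_eq_abs]
      rcases lt_or_ge (|y - x|) δ with hlt | hge
      · have h1 : |f y| ≤ η * y ^ lam := by linarith [hnear (y := y) hlt]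
        calc poissonKernel lam t x y * |f y| ≤ poissonKernel lam t x y * (η * y ^ lam) := by gcongr
          _ = η * (poissonKernel lam t x y * y ^ lam) := by ring
          _ ≤ _ := le_add_of_nonneg_right n2
      · calc poissonKernel lam t x y * |f y| ≤ _ * |f y| :=
              mul_le_mul_of_nonneg_right (poissonKernel_le hlam ht hx hy hδ hge) (abs_nonneg _)
          _ = t * K * ‖y ^ lam * f y * (1 + y ^ 2) ^ (-(lam + 1))‖ := by
            rw [norm_mul, norm_mul, Real.norm_of_nonneg (r := y ^ lam) (by positivity),
              Real.norm_of_nonneg (r := (1 + y ^ 2) ^ _) (by positivity), Real.norm_eq_abs, hK,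
              Real.mul_rpow hx.le hy.le]
            ring
          _ ≤ _ := le_add_of_nonneg_left n1
  have hlim : ∀ᶠ t in 𝓝[>] (0 : ℝ), ε / 2 + t * (K * M) < ε := by
    have : Tendsto (fun t : ℝ => ε / 2 + t * (K * M)) (𝓝[>] 0) (𝓝 (ε / 2 + 0 * (K * M))) := by
      refine Tendsto.mono_left (Continuous.tendsto ?_ 0) nhdsWithin_le_nhds
      fun_prop
    exact this.eventually_lt_const (by linarith)
  filter_upwards [hlim, self_mem_nhdsWithin] with t h1 ht
  rw [Real.dist_eq, sub_zero]
  exact (hbound t ht).trans_lt h1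

lemma tendsto_poisson (hlam : 0 < lam) (hf : PoissonIntegrable lam f) (hx : 0 < x)
    (hfx : ContinuousAt f x) :
    Tendsto (fun t => poisson lam t f x) (𝓝[>] 0) (𝓝 (f x)) := by
  -- With this `c`, `f - c y^lam` vanishes at `x` and `P_t(c y^lam)(x) = f x` for every `t`.
  set c := f x / x ^ lam
  have hxl : 0 < x ^ lam := by positivity
  have hp := poissonIntegrable_rpow hlam
  have hg : PoissonIntegrable lam (fun y => f y - c * y ^ lam) := by
    refine (hf.sub (hp.const_mul c)).congr (Eventually.of_forall fun y => ?_)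
    simp only [Pi.sub_apply]
    ring
  have h := tendsto_integral_poissonKernel_mul_zero hlam hg hx
    (hfx.sub (continuousAt_const.mul (Real.continuousAt_rpow_const _ _ (Or.inl hx.ne'))))
    (by simp only [c]; field_simp; ring)
  rw [← zero_add (f x)]
  refine (h.add_const (f x)).congr' ?_
  filter_upwards [self_mem_nhdsWithin] with t ht
  have ht : 0 < t := ht
  have e : ∀ y, poissonKernel lam t x y * (f y - c * y ^ lam)
      = poissonKernel lam t x y * f y - c * (poissonKernel lam t x y * y ^ lam) := fun y => by ring
  simp_rw [e]
  rw [integral_sub (integrableOn_poissonKernel_mul hlam hf ht hx)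
    ((integrableOn_poissonKernel_mul hlam hp ht hx).const_mul c), integral_const_mul,
    ← poisson_eq_integral_poissonKernel hlam hf ht hx,
    ← poisson_eq_integral_poissonKernel hlam hp ht hx, poisson_rpow hlam ht hx]
  simp only [c]
  field_simp
  ring

end Boundary

end BesselHarmonic

theorem proposition3 (lam α : ℝ) (hlam : 0 < lam) (hα0 : 0 < α) (hα1 : α < 1)
    (f : ℝ → ℝ) (hfL : BesselHarmonic.MemL (lam / 2) f) (hfα : BesselHarmonic.MemHolder α f) :
    -- the integral that defines `W_s f(x)` converges absolutely
    (∀ x > 0, ∀ s > 0,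
      IntegrableOn (fun y => BesselHarmonic.heatKernel lam s x y * f y) (Ioi 0)) ∧
    -- so does the subordination integral that defines `P_t f(x)`
    (∀ x > 0, ∀ t > 0,
      IntegrableOn (fun s => Real.exp (-t ^ 2 / (4 * s)) / s ^ (3 / 2 : ℝ) *
        BesselHarmonic.heat lam s f x) (Ioi 0)) ∧
    -- `v(x, t) = P_t f(x)` is a classical solution
    BesselHarmonic.IsClassicalSolution lam f (fun x t => BesselHarmonic.poisson lam t f x) ∧
    -- the two absolutely convergent integrals for the Poisson kernel agree
    (∀ x > 0, ∀ y > 0, ∀ t > 0,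
      IntegrableOn (fun s => Real.exp (-t ^ 2 / (4 * s)) / s ^ (3 / 2 : ℝ) *
        BesselHarmonic.heatKernel lam s x y) (Ioi 0) ∧
      IntegrableOn (fun r => Real.exp (-r) / r ^ (1 / 2 : ℝ) *
        BesselHarmonic.heatKernel lam (t ^ 2 / (4 * r)) x y) (Ioi 0) ∧
      BesselHarmonic.poissonKernel lam t x y =
        1 / Real.sqrt Real.pi * ∫ r in Ioi (0 : ℝ), Real.exp (-r) / r ^ (1 / 2 : ℝ) *
          BesselHarmonic.heatKernel lam (t ^ 2 / (4 * r)) x y) ∧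
    -- `v` is given by integration against the Poisson kernel
    (∀ x > 0, ∀ t > 0,
      IntegrableOn (fun y => BesselHarmonic.poissonKernel lam t x y * f y) (Ioi 0) ∧
      BesselHarmonic.poisson lam t f x =
        ∫ y in Ioi (0 : ℝ), BesselHarmonic.poissonKernel lam t x y * f y) := by

  have hf := hfL.poissonIntegrable hlam
  refine ⟨fun x hx s hs => BesselHarmonic.integrableOn_heatKernel_mul hlam hf hs hx,
    fun x hx t ht => BesselHarmonic.integrableOn_subordination_mul_heat hlam hf ht hx,
    ⟨BesselHarmonic.contDiffOn_poisson hlam hf,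
      fun x hx t ht => BesselHarmonic.poisson_equation hlam hf hx ht,
      fun x hx => BesselHarmonic.tendsto_poisson hlam hf hx
        (hfα.1.continuousAt (Ioi_mem_nhds hx))⟩,
    fun x hx y hy t ht => ⟨BesselHarmonic.integrableOn_subordination_mul_heatKernel hlam ht hx hy,
      BesselHarmonic.integrableOn_exp_neg_mul_heatKernel hlam ht hx hy,
      BesselHarmonic.poissonKernel_eq_integral_exp_neg ht⟩,
    fun x hx t ht => ⟨BesselHarmonic.integrableOn_poissonKernel_mul hlam hf ht hx,
      BesselHarmonic.poisson_eq_integral_poissonKernel hlam hf ht hx⟩⟩
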